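/- Fix constants $\lambda>0$, $\gamma_{\mathrm{TF}}>0$ and a nuclear charge $Z>0$. Let $\mathcal A=\{\rho:\mathbb R^3\to\mathbb R \mid \rho\ge 0 \text{ a.e.},\ \sqrt\rho\in H^1(\mathbb R^3)\}$, and for $\rho\in\mathcal A$ let $$\mathcal E^{\mathrm{TFW}}_Z(\rho)=\frac{\lambda}{2}\int_{\mathbb R^3}|\nabla\sqrt{\rho}|^2\,dx +\int_{\mathbb R^3}\Bigl(\tfrac35\gamma_{\mathrm{TF}}\,\rho(x)^{5/3}-\frac{Z}{|x|}\rho(x)\Bigr)dx +\frac12\int_{\mathbb R^3}\int_{\mathbb R^3}\frac{\rho(x)\rho(y)}{|x-y|}\,dx\,dy$$ be the Thomas--Fermi--Weizsäcker functional of an atom. If $\rho_Z\in\mathcal A$ is the (unrestricted) minimizer of $\mathcal E^{\mathrm{TFW}}_Z$ on $\mathcal A$, i.e. $\mathcal E^{\mathrm{TFW}}_Z(\rho_Z)\le\mathcal E^{\mathrm{TFW}}_Z(\rho)$ for all $\rho\in\mathcal A$, then its mass $N_c:=\int_{\mathbb R^3}\rho_Z\,dx$ satisfies $$N_c<2Z.$$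 -/

import Mathlib

open MeasureTheory Set
open scoped ContDiff Gradient

namespace TFW

noncomputable section

/-- Physical space `ℝ³` with the Euclidean norm. -/
abbrev R3 : Type := EuclideanSpace ℝ (Fin 3)

/-- `g` is a weak (distributional) gradient of `u` on `ℝ³`:
`∫ u ∇φ = - ∫ φ g` for all real test functions `φ ∈ C_c^∞(ℝ³)`. -/
def HasWeakGradient (u : R3 → ℝ) (g : R3 → R3) : Prop :=
  LocallyIntegrable u volume ∧ LocallyIntegrable g volume ∧
    ∀ φ : R3 → ℝ, ContDiff ℝ ∞ φ → HasCompactSupport φ →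
      ∫ x, u x • ∇ φ x = - ∫ x, φ x • g x

/-- Weak gradients are unique up to null sets. -/
theorem HasWeakGradient.ae_eq {u : R3 → ℝ} {g h : R3 → R3}
    (hg : HasWeakGradient u g) (hh : HasWeakGradient u h) : g =ᵐ[volume] h := by
  refine ae_eq_of_integral_contDiff_smul_eq hg.2.1 hh.2.1 fun φ h1 h2 => ?_
  exact neg_injective ((hg.2.2 φ h1 h2).symm.trans (hh.2.2 φ h1 h2))

open Classical in
/-- The weak gradient of `u` (`0` if there is none); see `weakGradient_ae_eq`. -/
def weakGradient (u : R3 → ℝ) : R3 → R3 :=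
  if h : ∃ g, HasWeakGradient u g then h.choose else 0

theorem weakGradient_ae_eq {u : R3 → ℝ} {g : R3 → R3} (hg : HasWeakGradient u g) :
    weakGradient u =ᵐ[volume] g := by
  have h : ∃ g, HasWeakGradient u g := ⟨g, hg⟩
  rw [weakGradient, dif_pos h]
  exact h.choose_spec.ae_eq hg

/-- The Sobolev space `H¹(ℝ³)` of (real) square integrable functions with square integrable
weak gradient. -/
def MemH1 (u : R3 → ℝ) : Prop :=
  MemLp u 2 volume ∧ ∃ g : R3 → R3, HasWeakGradient u g ∧ MemLp g 2 volume

/-- The set of densities `{ρ | ρ ≥ 0, √ρ ∈ H¹(ℝ³)}`. -/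
def densities : Set (R3 → ℝ) :=
  {ρ | (∀ᵐ x, 0 ≤ ρ x) ∧ MemH1 fun x => Real.sqrt (ρ x)}

/-- Densities are integrable, so that the mass `∫ ρ` is meaningful. -/
theorem integrable_of_mem_densities {ρ : R3 → ℝ} (h : ρ ∈ densities) :
    Integrable ρ volume := by
  refine (h.2.1.integrable_sq).congr ?_
  filter_upwards [h.1] with x hx using Real.sq_sqrt hx

/-- The classical Coulomb self-energy
`D[ρ] = ½ ∫∫ ρ(x) ρ(y) / |x - y| dx dy`. -/
def coulombEnergy (ρ : R3 → ℝ) : ℝ :=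
  (1 / 2) * ∫ x, ∫ y, ρ x * ρ y / ‖x - y‖

/-- The Thomas-Fermi functional of an atom with nuclear charge `Z`, with Thomas-Fermi
constant `γ`: `∫ (3/5 γ ρ^{5/3} - Z/|x| ρ) + D[ρ]`. -/
def thomasFermi (γ Z : ℝ) (ρ : R3 → ℝ) : ℝ :=
  (∫ x, ((3 / 5) * γ * ρ x ^ (5 / 3 : ℝ) - Z / ‖x‖ * ρ x)) + coulombEnergy ρ

/-- The Thomas-Fermi-Weizsäcker functional `λ/2 ∫ |∇√ρ|² + E^TF(ρ)`. -/
def thomasFermiWeizsacker (lam γ Z : ℝ) (ρ : R3 → ℝ) : ℝ :=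
  lam / 2 * (∫ x, ‖weakGradient (fun y => Real.sqrt (ρ y)) x‖ ^ 2) + thomasFermi γ Z ρ

/-- `ρ` is an unrestricted minimizer of the Thomas-Fermi-Weizsäcker functional, i.e. a
minimizer on the set of all densities, without a constraint on the mass. -/
def IsTFWMinimizer (lam γ Z : ℝ) (ρ : R3 → ℝ) : Prop :=
  ρ ∈ densities ∧ IsMinOn (thomasFermiWeizsacker lam γ Z) densities ρ

end

end TFW

/-! The proof is Lieb's argument: test minimality against the weight `|x|`. Put `u = √ρ`, `N = ∫
u²`, and compare `u` with `(1 - tη)u` for a weight `η ≥ 0`. Dividing by `t` and letting `t → 0⁺`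
gives `λ ∫ ∇u·∇(ηu) + (3/5)γ ∫ η ρ^(5/3) + ∬ (η(x) + η(y)) ρ(x)ρ(y)/|x-y| ≤ 2Z ∫ ηρ/|x|`. Formally
take `η = |x|`. The right side is `2ZN`. By the triangle inequality the Coulomb term is at least
`N²`. The kinetic term is nonnegative because `1/|x|` is superharmonic. The Thomas-Fermi term is
positive unless `ρ = 0`, so `N² < 2ZN`.

Since `|x|` is neither bounded nor smooth, it is replaced by `η = s/(1 + εs)` with `s = √(|x|² +
δ²)`. Here `1/η = ε + 1/s` is still superharmonic, and `r ↦ r/(1 + εr)` is still increasing and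
subadditive. The limit `δ = ε → 0` restores the formal inequality.

The variational inequality is `weighted_virial_le`, its kinetic part is
`HasWeakGradient.integral_weight_mul_nonneg`, and the limit is `charge_sq_le`. All integrals must be
finite for the energy to be expanded: approximation in `H¹` by test functions yields the Sobolev
embedding (for `ρ^(5/3)`) and integration by parts against radial fields, hence a Hardy inequality
uniform in its centre (for both Coulomb terms). -/

namespace TFW
open Filter Topology ContinuousLinearMap
open scoped Convolution ENNReal NNReal RealInnerProductSpace

/-! ### Convergence of mollifications in `L²`. -/

section Mollification

variable {F : Type*} [NormedAddCommGroup F]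

theorem eLpNorm_two_sq {α : Type*} [MeasurableSpace α] {μ : Measure α} (f : α → F) :
    eLpNorm f 2 μ ^ 2 = ∫⁻ x, ‖f x‖ₑ ^ 2 ∂μ := by
  have := eLpNorm_nnreal_pow_eq_lintegral (μ := μ) (f := f) (p := 2) two_ne_zero
  simpa using this

/-- Translations act continuously on `L²`. -/
theorem tendsto_eLpNorm_translate_sub {f : R3 → F} (hf : MemLp f 2 volume) :
    Tendsto (fun y : R3 => eLpNorm (fun x => f (x - y) - f x) 2 volume) (𝓝 0) (𝓝 0) := by
  have hm : ∀ y : R3, MeasurePreserving (fun x : R3 => x - y) volume volume :=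
    fun y => measurePreserving_sub_right volume y
  -- Continuity of composition on `Lp` is available for maps varying continuously in the
  -- compact-open topology, so translation is curried.
  let T : C(R3, C(R3, R3)) :=
    ContinuousMap.curry ⟨fun p : R3 × R3 => p.2 - p.1, by fun_prop⟩
  have hT : ∀ y, MeasurePreserving (T y) (volume : Measure R3) volume := hm
  have hc : Continuous fun y => Lp.compMeasurePreserving (T y) (hT y) (hf.toLp f) :=
    Continuous.compMeasurePreservingLp (f := fun _ => hf.toLp f) (g := fun y => T y)
      continuous_const T.continuous hT (ENNReal.ofNat_ne_top (n := 2))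
  have h0 := (hc.tendsto 0)
  have hT0 : Lp.compMeasurePreserving (T 0) (hT 0) (hf.toLp f) = hf.toLp f := by
    apply Lp.ext
    refine (Lp.coeFn_compMeasurePreserving _ _).trans ?_
    filter_upwards with x
    simp [T]
  rw [hT0, tendsto_iff_edist_tendsto_0] at h0
  refine h0.congr fun y => ?_
  rw [Lp.edist_def]
  refine eLpNorm_congr_ae ?_
  have h1 := Lp.coeFn_compMeasurePreserving (hf.toLp f) (hT y)
  have h2 := hf.coeFn_toLp
  filter_upwards [h1, h2, (hT y).quasiMeasurePreserving.ae h2] with x h1 h2 h3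
  simp only [Pi.sub_apply, h1, h2, Function.comp, h3]
  rfl

variable [NormedSpace ℝ F] [CompleteSpace F]

/-- The normalized bump is a probability density, so the difference is an average of `f (x - y) - f
x`. Its squared norm is at most the average of the squares, and Tonelli reduces the claim to single
translations within the support of the bump. -/
theorem eLpNorm_convolution_sub_le (φ : ContDiffBump (0 : R3)) {f : R3 → F}
    (hf : MemLp f 2 volume) {ε : ℝ≥0∞}
    (hε : ∀ y : R3, ‖y‖ < φ.rOut → eLpNorm (fun x => f (x - y) - f x) 2 volume ≤ ε) :
    eLpNorm (fun x => (φ.normed volume ⋆[lsmul ℝ ℝ, volume] f) x - f x) 2 volume ≤ ε := by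
  set w : R3 → ℝ := φ.normed volume with hw
  have hw0 : ∀ y, 0 ≤ w y := φ.nonneg_normed
  have hwc : Continuous w := φ.continuous_normed
  have hwi : Integrable w volume := φ.integrable_normed
  have hfl : LocallyIntegrable f volume := hf.locallyIntegrable (by norm_num)
  set μ : Measure R3 := volume.withDensity fun y => ENNReal.ofReal (w y) with hμ
  have hμac : μ ≪ volume := withDensity_absolutelyContinuous _ _
  have : IsProbabilityMeasure μ := ⟨by
    rw [hμ, withDensity_apply _ MeasurableSet.univ, Measure.restrict_univ,
      ← ofReal_integral_eq_lintegral_ofReal hwi (ae_of_all _ hw0), φ.integral_normed]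
    simp⟩
  have hmeas : Measurable fun y => ENNReal.ofReal (w y) := by fun_prop
  have hft : ∀ x, AEStronglyMeasurable (fun y => f (x - y) - f x) (volume : Measure R3) :=
    fun x => (hf.1.comp_measurePreserving
      (Measure.measurePreserving_sub_left volume x)).sub aestronglyMeasurable_const
  have key : ∀ x, ‖(w ⋆[lsmul ℝ ℝ, volume] f) x - f x‖ₑ ^ 2
      ≤ ∫⁻ y, ‖f (x - y) - f x‖ₑ ^ 2 ∂μ := by
    intro x
    have hex : Integrable (fun y => w y • f (x - y)) volume :=
      φ.hasCompactSupport_normed.convolutionExists_left (lsmul ℝ ℝ) hwc hfl x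
    have h1 : (w ⋆[lsmul ℝ ℝ, volume] f) x - f x = ∫ y, w y • (f (x - y) - f x) := by
      simp_rw [smul_sub]
      rw [integral_sub hex (hwi.smul_const _), integral_smul_const, φ.integral_normed, one_smul]
      rfl
    have h2 : ‖(w ⋆[lsmul ℝ ℝ, volume] f) x - f x‖ₑ ≤ eLpNorm (fun y => f (x - y) - f x) 1 μ := by
      rw [h1, eLpNorm_one_eq_lintegral_enorm]
      refine (enorm_integral_le_lintegral_enorm _).trans (le_of_eq ?_)
      rw [hμ, lintegral_withDensity_eq_lintegral_mul₀ hmeas.aemeasurable (hft x).enorm]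
      refine lintegral_congr fun y => ?_
      rw [enorm_smul, Real.enorm_of_nonneg (hw0 y)]
      rfl
    have h3 := h2.trans (eLpNorm_le_eLpNorm_of_exponent_le one_le_two ((hft x).mono_ac hμac))
    calc _ ≤ _ := pow_le_pow_left' h3 2
      _ = _ := eLpNorm_two_sq _
  rw [← ENNReal.pow_le_pow_left_iff two_ne_zero, eLpNorm_two_sq]
  have hprod : AEStronglyMeasurable (fun p : R3 × R3 => f (p.1 - p.2) - f p.1)
      ((volume : Measure R3).prod volume) :=
    (hf.1.comp_quasiMeasurePreserving
      (quasiMeasurePreserving_sub volume volume)).sub hf.1.comp_fst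
  have hac : (volume : Measure R3).prod μ ≪ (volume : Measure R3).prod volume :=
    Measure.AbsolutelyContinuous.rfl.prod hμac
  calc ∫⁻ x, ‖(w ⋆[lsmul ℝ ℝ, volume] f) x - f x‖ₑ ^ 2
      ≤ ∫⁻ x, (∫⁻ y, ‖f (x - y) - f x‖ₑ ^ 2 ∂μ) := lintegral_mono key
    _ = ∫⁻ y, (∫⁻ x, ‖f (x - y) - f x‖ₑ ^ 2) ∂μ :=
        lintegral_lintegral_swap ((hprod.mono_ac hac).enorm.pow_const 2)
    _ ≤ ∫⁻ _, ε ^ 2 ∂μ := by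
        refine lintegral_mono_ae ?_
        rw [hμ, ae_withDensity_iff hmeas]
        refine ae_of_all _ fun y hy => ?_
        rw [← eLpNorm_two_sq]
        refine pow_le_pow_left' (hε y ?_) 2
        have : y ∈ Function.support w := by
          intro h0
          simp [h0] at hy
        rw [hw, φ.support_normed_eq] at this
        simpa using this
    _ = ε ^ 2 := by simp

/-- The mollifications of `f ∈ L²` by bumps of radius tending to zero converge to `f`. -/
theorem exists_bump_eLpNorm_convolution_sub_le {f : R3 → F} (hf : MemLp f 2 volume) {ε : ℝ≥0∞}
    (hε : 0 < ε) : ∃ r > 0, ∀ φ : ContDiffBump (0 : R3), φ.rOut ≤ r →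
      eLpNorm (fun x => (φ.normed volume ⋆[lsmul ℝ ℝ, volume] f) x - f x) 2 volume ≤ ε := by
  have := (tendsto_eLpNorm_translate_sub hf).eventually (Iic_mem_nhds hε)
  obtain ⟨r, hr, h⟩ := Metric.eventually_nhds_iff.1 this
  refine ⟨r, hr, fun φ hφ => eLpNorm_convolution_sub_le φ hf fun y hy => h ?_⟩
  simpa using hy.trans_le hφ

end Mollification

/-! ### Calculus of weak gradients: products and convolutions. -/

section WeakGradients

theorem contDiff_gradient {φ : R3 → ℝ} (hφ : ContDiff ℝ ∞ φ) : ContDiff ℝ ∞ (∇ φ) := by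
  have h := hφ.fderiv_right (m := ∞) le_rfl
  exact (InnerProductSpace.toDual ℝ R3).symm.toContinuousLinearEquiv.contDiff.comp h

theorem hasCompactSupport_gradient {φ : R3 → ℝ} (hφ : HasCompactSupport φ) :
    HasCompactSupport (∇ φ) := by
  refine (hφ.fderiv ℝ).comp_left (g := (InnerProductSpace.toDual ℝ R3).symm) (map_zero _)

theorem gradient_mul {φ η : R3 → ℝ} {x : R3} (hη : DifferentiableAt ℝ η x)
    (hφ : DifferentiableAt ℝ φ x) :
    ∇ (fun y => η y * φ y) x = η x • ∇ φ x + φ x • ∇ η x := by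
  refine ext_inner_right ℝ fun v => ?_
  simp only [inner_gradient_left, inner_add_left, inner_smul_left, fderiv_fun_mul hη hφ]
  simp

/-- Test the weak gradient of `u` against `ηφ` and expand `∇(ηφ)`. -/
theorem HasWeakGradient.smooth_mul {u : R3 → ℝ} {g : R3 → R3} (h : HasWeakGradient u g)
    {η : R3 → ℝ} (hη : ContDiff ℝ ∞ η) :
    HasWeakGradient (fun x => η x * u x) (fun x => η x • g x + u x • ∇ η x) := by
  have hgc : Continuous (∇ η) := (contDiff_gradient hη).continuous
  have hug : LocallyIntegrable (fun x => u x • ∇ η x) volume := h.1.smul_continuous hgc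
  refine ⟨h.1.continuous_smul hη.continuous, (h.2.1.continuous_smul hη.continuous).add hug,
    fun φ hφ hφc => ?_⟩
  have hφcont := hφ.continuous
  have h1 := h.2.2 (fun x => η x * φ x) (hη.mul hφ) hφc.mul_left
  have h2 : ∀ x, u x • ∇ (fun y => η y * φ y) x
      = (η x * u x) • ∇ φ x + φ x • u x • ∇ η x := by
    intro x
    rw [gradient_mul (hη.differentiable (by simp)).differentiableAt
      (hφ.differentiable (by simp)).differentiableAt]
    module
  have i1 : Integrable (fun x => (η x * u x) • ∇ φ x) volume :=
    (h.1.continuous_smul hη.continuous).integrable_smul_right_of_hasCompactSupport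
      (contDiff_gradient hφ).continuous (hasCompactSupport_gradient hφc)
  have i2 : Integrable (fun x => φ x • u x • ∇ η x) volume :=
    hug.integrable_smul_left_of_hasCompactSupport hφcont hφc
  have i3 : Integrable (fun x => φ x • η x • g x) volume :=
    (h.2.1.continuous_smul hη.continuous).integrable_smul_left_of_hasCompactSupport hφcont hφc
  simp_rw [h2] at h1
  rw [integral_add i1 i2] at h1
  simp_rw [smul_add]
  rw [integral_add i3 i2, neg_add, eq_add_neg_of_add_eq h1]
  congr 2
  refine integral_congr_ae (ae_of_all _ fun x => ?_)
  module

theorem gradient_comp_sub_left {w : R3 → ℝ} (hw : ContDiff ℝ ∞ w) (x z : R3) :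
    ∇ (fun y => w (x - y)) z = - ∇ w (x - z) := by
  refine ext_inner_right ℝ fun v => ?_
  rw [inner_neg_left, inner_gradient_left, inner_gradient_left]
  have h1 : HasFDerivAt (fun y => w (x - y)) ((fderiv ℝ w (x - z)).comp (-ContinuousLinearMap.id ℝ R3)) z :=
    ((hw.differentiable (by simp)) (x - z)).hasFDerivAt.comp z ((hasFDerivAt_id z).const_sub x)
  rw [h1.fderiv]
  simp

/-- The derivative falls on the smooth factor, and `z ↦ w (x - z)` is then an admissible test
function; the sign from the reflection cancels the one from the weak gradient. -/
theorem HasWeakGradient.gradient_convolution {u : R3 → ℝ} {g : R3 → R3}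
    (h : HasWeakGradient u g) {w : R3 → ℝ} (hw : ContDiff ℝ ∞ w) (hwc : HasCompactSupport w)
    (x : R3) : ∇ (w ⋆[lsmul ℝ ℝ, volume] u) x = (w ⋆[lsmul ℝ ℝ, volume] g) x := by
  have hxc : HasCompactSupport fun z => w (x - z) :=
    hwc.comp_homeomorph (Homeomorph.subLeft x)
  have hxs : ContDiff ℝ ∞ fun z => w (x - z) := hw.comp (contDiff_const.sub contDiff_id)
  have h1 := h.2.2 _ hxs hxc
  simp_rw [gradient_comp_sub_left hw, smul_neg, integral_neg, neg_inj] at h1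
  have hd := hwc.hasFDerivAt_convolution_left (lsmul ℝ ℝ) (hw.of_le (by simp)) h.1 x
  refine ext_inner_right ℝ fun v => ?_
  rw [inner_gradient_left, hd.fderiv, convolution_eq_swap (lsmul ℝ ℝ)]
  simp only [lsmul_apply]
  rw [← h1]
  rw [convolution_eq_swap]
  have i1 : Integrable (fun z => u z • ∇ w (x - z)) volume :=
    h.1.integrable_smul_right_of_hasCompactSupport
      ((contDiff_gradient hw).continuous.comp (continuous_const.sub continuous_id))
      ((hasCompactSupport_gradient hwc).comp_homeomorph (Homeomorph.subLeft x))
  have i2 : Integrable (fun z => ((lsmul ℝ ℝ).precompL R3) (fderiv ℝ w (x - z)) (u z)) volume := by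
    have := (hwc.fderiv ℝ).convolutionExists_left ((lsmul ℝ ℝ : ℝ →L[ℝ] ℝ →L[ℝ] ℝ).precompL R3)
      (hw.continuous_fderiv (by simp)) h.1 x
    exact this.integrable_swap
  rw [ContinuousLinearMap.integral_apply i2, real_inner_comm, ← integral_inner i1]
  refine integral_congr_ae (ae_of_all _ fun z => ?_)
  simp only [inner_smul_right, inner_gradient_right, precompL_apply, lsmul_apply]
  simp [mul_comm]

end WeakGradients

/-! ### Density of test functions in `H¹` and the Sobolev embedding. -/

section Cutoff

variable {F : Type*} [NormedAddCommGroup F] [NormedSpace ℝ F]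

theorem tendsto_eLpNorm_smul_sub {c : ℕ → R3 → ℝ} (hc : ∀ n, Continuous (c n))
    (hc0 : ∀ n x, 0 ≤ c n x) (hc1 : ∀ n x, c n x ≤ 1)
    (hlim : ∀ x, Tendsto (fun n => c n x) atTop (𝓝 1)) {f : R3 → F} (hf : MemLp f 2 volume) :
    Tendsto (fun n => eLpNorm (fun x => c n x • f x - f x) 2 volume) atTop (𝓝 0) := by
  have key : Tendsto (fun n => ∫⁻ x, ‖c n x • f x - f x‖ₑ ^ 2) atTop (𝓝 0) := by
    have : (0 : ℝ≥0∞) = ∫⁻ _ : R3, 0 := by simp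
    rw [this]
    refine tendsto_lintegral_of_dominated_convergence' (fun x => ‖f x‖ₑ ^ 2) (fun n => ?_)
      (fun n => ae_of_all _ fun x => ?_) ?_ (ae_of_all _ fun x => ?_)
    · exact (((hc n).aestronglyMeasurable.smul hf.1).sub hf.1).enorm.pow_const 2
    · refine pow_le_pow_left' ?_ 2
      have : c n x • f x - f x = (c n x - 1) • f x := by module
      rw [this, enorm_smul]
      refine mul_le_of_le_one_left' ?_
      rw [Real.enorm_eq_ofReal_abs, ENNReal.ofReal_le_one, abs_le]
      constructor <;> linarith [hc0 n x, hc1 n x]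
    · rw [← eLpNorm_two_sq]
      exact ENNReal.pow_ne_top hf.2.ne
    · have h1 : Tendsto (fun n => c n x • f x - f x) atTop (𝓝 0) := by
        simpa using ((hlim x).smul_const (f x)).sub_const (f x)
      have h2 := ((ENNReal.continuous_pow 2).tendsto _).comp h1.enorm
      simpa [Function.comp_def] using h2
  have h3 := ((ENNReal.continuous_rpow_const (y := (1 / 2 : ℝ))).tendsto _).comp key
  simp only [one_div, inv_pos, Nat.ofNat_pos, ENNReal.zero_rpow_of_pos] at h3
  refine h3.congr fun n => ?_
  simp only [Function.comp, ← eLpNorm_two_sq]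
  rw [← ENNReal.rpow_natCast, ← ENNReal.rpow_mul]
  simp

end Cutoff

/-- Multiply by the dilated cutoffs `χ(x/(n+1))`. Their gradients are `O(1/n)` uniformly, so the
extra term `u ∇c_n` of the product rule vanishes in `L²`. -/
theorem exists_compactSupport_approx {u : R3 → ℝ} {g : R3 → R3} (h : HasWeakGradient u g)
    (hu : MemLp u 2 volume) (hg : MemLp g 2 volume) {ε : ℝ≥0∞} (hε : 0 < ε) :
    ∃ v k, HasWeakGradient v k ∧ MemLp v 2 volume ∧ MemLp k 2 volume ∧ HasCompactSupport v ∧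
      eLpNorm (fun x => v x - u x) 2 volume ≤ ε ∧ eLpNorm (fun x => k x - g x) 2 volume ≤ ε := by
  let χ : ContDiffBump (0 : R3) := ⟨1, 2, one_pos, one_lt_two⟩
  let a : ℕ → ℝ := fun n => ((n : ℝ) + 1)⁻¹
  have ha : ∀ n, 0 < a n := fun n => by positivity
  have ha0 : Tendsto a atTop (𝓝 0) := by
    simpa [a] using tendsto_one_div_add_atTop_nhds_zero_nat (𝕜 := ℝ)
  let c : ℕ → R3 → ℝ := fun n x => χ (a n • x)
  have hcs : ∀ n, ContDiff ℝ ∞ (c n) := fun n => χ.contDiff.comp (contDiff_id.const_smul (a n))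
  have hlim : ∀ x, Tendsto (fun n => c n x) atTop (𝓝 1) := by
    intro x
    have h1 : Tendsto (fun n => a n • x) atTop (𝓝 0) := by simpa using ha0.smul_const x
    have h2 := (χ.continuous.tendsto 0).comp h1
    have h3 : χ 0 = 1 := χ.one_of_mem_closedBall (by simp [χ])
    rw [h3] at h2
    exact h2
  have hχs : ContDiff ℝ ∞ χ := χ.contDiff
  obtain ⟨C, hC⟩ := (hasCompactSupport_gradient χ.hasCompactSupport).exists_bound_of_continuous
    (contDiff_gradient hχs).continuous
  have hgrad : ∀ n x, ∇ (c n) x = a n • ∇ χ (a n • x) := by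
    intro n x
    refine ext_inner_right ℝ fun v => ?_
    rw [inner_smul_left, inner_gradient_left, inner_gradient_left]
    have h1 : HasFDerivAt (c n) ((fderiv ℝ χ (a n • x)).comp (a n • ContinuousLinearMap.id ℝ R3)) x :=
      ((hχs.differentiable (by simp)) (a n • x)).hasFDerivAt.comp x
        ((hasFDerivAt_id x).const_smul (a n))
    rw [h1.fderiv]
    simp
  have hgb : ∀ n x, ‖∇ (c n) x‖ ≤ a n * C := by
    intro n x
    rw [hgrad, norm_smul, Real.norm_of_nonneg (ha n).le]
    exact mul_le_mul_of_nonneg_left (hC _) (ha n).le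
  have hc0 : ∀ n x, 0 ≤ c n x := fun n x => χ.nonneg
  have hc1 : ∀ n x, c n x ≤ 1 := fun n x => χ.le_one
  have hccont : ∀ n, Continuous (c n) := fun n => (hcs n).continuous
  have t1 := tendsto_eLpNorm_smul_sub hccont hc0 hc1 hlim hu
  have t2 := tendsto_eLpNorm_smul_sub hccont hc0 hc1 hlim hg
  have hmg : ∀ n, AEStronglyMeasurable (fun x => u x • ∇ (c n) x) volume := fun n =>
    hu.1.smul (contDiff_gradient (hcs n)).continuous.aestronglyMeasurable
  have hle : ∀ n, eLpNorm (fun x => u x • ∇ (c n) x) 2 volume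
      ≤ ENNReal.ofReal (a n * C) * eLpNorm u 2 volume := fun n =>
    eLpNorm_le_mul_eLpNorm_of_ae_le_mul (ae_of_all _ fun x => by
      rw [norm_smul, mul_comm]
      exact mul_le_mul_of_nonneg_right (hgb n x) (norm_nonneg _)) 2
  have t3 : Tendsto (fun n => eLpNorm (fun x => u x • ∇ (c n) x) 2 volume) atTop (𝓝 0) := by
    refine tendsto_of_tendsto_of_tendsto_of_le_of_le tendsto_const_nhds ?_ (fun _ => zero_le) hle
    have := (ENNReal.tendsto_ofReal (ha0.mul_const C))
    have := ENNReal.Tendsto.mul_const (b := eLpNorm u 2 volume) this (Or.inr hu.2.ne)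
    simpa using this
  have t4 : Tendsto (fun n => eLpNorm (fun x => c n x • g x - g x) 2 volume
      + eLpNorm (fun x => u x • ∇ (c n) x) 2 volume) atTop (𝓝 0) := by simpa using t2.add t3
  obtain ⟨n, hn1, hn2⟩ := ((t1.eventually (Iic_mem_nhds hε)).and
    (t4.eventually (Iic_mem_nhds hε))).exists
  have m1 : MemLp (fun x => c n x • g x) 2 volume :=
    hg.of_le ((hccont n).aestronglyMeasurable.smul hg.1) (ae_of_all _ fun x => by
      rw [norm_smul, Real.norm_of_nonneg (hc0 n x)]
      exact mul_le_of_le_one_left (norm_nonneg _) (hc1 n x))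
  have m2 : MemLp (fun x => u x • ∇ (c n) x) 2 volume :=
    ⟨hmg n, (hle n).trans_lt (ENNReal.mul_lt_top ENNReal.ofReal_lt_top hu.2)⟩
  refine ⟨_, _, h.smooth_mul (hcs n), ?_, m1.add m2, ?_, hn1, le_trans ?_ hn2⟩
  · exact hu.of_le ((hccont n).aestronglyMeasurable.mul hu.1) (ae_of_all _ fun x => by
      rw [norm_mul, Real.norm_of_nonneg (hc0 n x)]
      exact mul_le_of_le_one_left (norm_nonneg _) (hc1 n x))
  · refine HasCompactSupport.mul_right ?_
    exact χ.hasCompactSupport.comp_homeomorph (Homeomorph.smulOfNeZero (a n) (ha n).ne')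
  · refine le_trans (le_of_eq ?_) (eLpNorm_add_le (m1.1.sub hg.1) m2.1 one_le_two)
    congr 1
    ext1 x
    simp only [Pi.add_apply]
    abel

/-- Smooth compactly supported functions are dense in `H¹`. -/
theorem exists_smooth_approx {u : R3 → ℝ} {g : R3 → R3} (h : HasWeakGradient u g)
    (hu : MemLp u 2 volume) (hg : MemLp g 2 volume) {ε : ℝ≥0∞} (hε : 0 < ε) :
    ∃ φ : R3 → ℝ, ContDiff ℝ ∞ φ ∧ HasCompactSupport φ ∧
      eLpNorm (fun x => φ x - u x) 2 volume ≤ ε ∧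
      eLpNorm (fun x => ∇ φ x - g x) 2 volume ≤ ε := by
  have hε2 : 0 < ε / 2 := ENNReal.half_pos hε.ne'
  obtain ⟨v, k, hvk, hv, hk, hvc, h1, h2⟩ := exists_compactSupport_approx h hu hg hε2
  obtain ⟨r, hr, hr1⟩ := exists_bump_eLpNorm_convolution_sub_le hv hε2
  obtain ⟨s, hs, hs1⟩ := exists_bump_eLpNorm_convolution_sub_le hk hε2
  have hm : 0 < min r s := lt_min hr hs
  -- One bump must serve both the function and its gradient, hence the minimum of the two radii.
  let φ : ContDiffBump (0 : R3) := ⟨min r s / 2, min r s, half_pos hm, half_lt_self hm⟩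
  have a1 := hr1 φ (min_le_left r s)
  have a2 := hs1 φ (min_le_right r s)
  have hw : ContDiff ℝ ∞ (φ.normed (volume : Measure R3)) := φ.contDiff_normed
  have hwc := φ.hasCompactSupport_normed (μ := (volume : Measure R3))
  have hgr := fun x => hvk.gradient_convolution hw hwc x
  have hs : ContDiff ℝ ∞ (φ.normed volume ⋆[lsmul ℝ ℝ, volume] v) :=
    hwc.contDiff_convolution_left (lsmul ℝ ℝ) hw hvk.1
  refine ⟨φ.normed volume ⋆[lsmul ℝ ℝ, volume] v, hs,
    hwc.convolution (lsmul ℝ ℝ) hvc, ?_, ?_⟩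
  · calc _ ≤ _ := eLpNorm_add_le (f := fun x => (φ.normed volume ⋆[lsmul ℝ ℝ, volume] v) x - v x)
          (g := fun x => v x - u x) (hs.continuous.aestronglyMeasurable.sub hv.1)
          (hv.1.sub hu.1) one_le_two |> le_trans (le_of_eq (by congr 1; ext1 x; simp))
      _ ≤ ε / 2 + ε / 2 := add_le_add a1 h1
      _ = ε := ENNReal.add_halves ε
  · simp_rw [hgr]
    have hcont : AEStronglyMeasurable (φ.normed volume ⋆[lsmul ℝ ℝ, volume] k) volume :=
      (hwc.contDiff_convolution_left (lsmul ℝ ℝ) hw hvk.2.1).continuous.aestronglyMeasurable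
    calc _ ≤ _ := eLpNorm_add_le (f := fun x => (φ.normed volume ⋆[lsmul ℝ ℝ, volume] k) x - k x)
          (g := fun x => k x - g x) (hcont.sub hk.1)
          (hk.1.sub hg.1) one_le_two |> le_trans (le_of_eq (by congr 1; ext1 x; simp))
      _ ≤ ε / 2 + ε / 2 := add_le_add a2 h2
      _ = ε := ENNReal.add_halves ε

theorem tendsto_integral_mul_of_tendsto_eLpNorm {α : Type*} [MeasurableSpace α] {μ : Measure α}
    {f h : ℕ → α → ℝ} {f₀ h₀ : α → ℝ}
    (hf : ∀ n, MemLp (f n) 2 μ) (hh : ∀ n, MemLp (h n) 2 μ) (hf₀ : MemLp f₀ 2 μ)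
    (hh₀ : MemLp h₀ 2 μ)
    (tf : Tendsto (fun n => eLpNorm (fun x => f n x - f₀ x) 2 μ) atTop (𝓝 0))
    (th : Tendsto (fun n => eLpNorm (fun x => h n x - h₀ x) 2 μ) atTop (𝓝 0)) :
    Tendsto (fun n => ∫ x, f n x * h n x ∂μ) atTop (𝓝 (∫ x, f₀ x * h₀ x ∂μ)) := by
  have key : ∀ {v w : α → ℝ} (hv : MemLp v 2 μ) (hw : MemLp w 2 μ),
      ⟪hv.toLp v, hw.toLp w⟫ = ∫ x, v x * w x ∂μ := by
    intro v w hv hw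
    rw [L2.inner_def]
    refine integral_congr_ae ?_
    filter_upwards [hv.coeFn_toLp, hw.coeFn_toLp] with x h1 h2
    rw [h1, h2]
    simp [mul_comm]
  have lf : Tendsto (fun n => (hf n).toLp (f n)) atTop (𝓝 (hf₀.toLp f₀)) :=
    (Lp.tendsto_Lp_iff_tendsto_eLpNorm'' _ hf _ hf₀).2 tf
  have lh : Tendsto (fun n => (hh n).toLp (h n)) atTop (𝓝 (hh₀.toLp h₀)) :=
    (Lp.tendsto_Lp_iff_tendsto_eLpNorm'' _ hh _ hh₀).2 th
  have := lf.inner lh (𝕜 := ℝ)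
  simpa only [key] using this

/-- `H¹` functions are limits of sequences of smooth compactly supported functions. -/
theorem exists_smooth_seq {u : R3 → ℝ} {g : R3 → R3} (h : HasWeakGradient u g)
    (hu : MemLp u 2 volume) (hg : MemLp g 2 volume) :
    ∃ φ : ℕ → R3 → ℝ, (∀ n, ContDiff ℝ ∞ (φ n)) ∧ (∀ n, HasCompactSupport (φ n)) ∧
      Tendsto (fun n => eLpNorm (fun x => φ n x - u x) 2 volume) atTop (𝓝 0) ∧
      Tendsto (fun n => eLpNorm (fun x => ∇ (φ n) x - g x) 2 volume) atTop (𝓝 0) := by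
  have hpos : ∀ n : ℕ, (0 : ℝ≥0∞) < ((n : ℝ≥0∞) + 1)⁻¹ := fun n => by simp
  choose φ h1 h2 h3 h4 using fun n : ℕ => exists_smooth_approx h hu hg (hpos n)
  have hlim : Tendsto (fun n : ℕ => ((n : ℝ≥0∞) + 1)⁻¹) atTop (𝓝 0) := by
    have := (tendsto_add_atTop_iff_nat 1).2 ENNReal.tendsto_inv_nat_nhds_zero
    simpa using this
  exact ⟨φ, h1, h2,
    tendsto_of_tendsto_of_tendsto_of_le_of_le tendsto_const_nhds hlim (fun _ => zero_le) h3,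
    tendsto_of_tendsto_of_tendsto_of_le_of_le tendsto_const_nhds hlim (fun _ => zero_le) h4⟩

/-- The Sobolev embedding `H¹(ℝ³) ⊂ L⁶(ℝ³)`. -/
theorem HasWeakGradient.memLp_six {u : R3 → ℝ} {g : R3 → R3} (h : HasWeakGradient u g)
    (hu : MemLp u 2 volume) (hg : MemLp g 2 volume) : MemLp u 6 volume := by
  obtain ⟨φ, h1, h2, h3, h4⟩ := exists_smooth_seq h hu hg
  have hm := tendstoInMeasure_of_tendsto_eLpNorm (p := 2) two_ne_zero
    (fun n => (h1 n).continuous.aestronglyMeasurable) hu.1 h3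
  obtain ⟨ns, hns, hae⟩ := hm.exists_seq_tendsto_ae
  refine ⟨hu.1, ?_⟩
  -- The `L⁶` norm is lower semicontinuous along an a.e. convergent subsequence, so a bound holding
  -- eventually suffices.
  have hF := Lp.eLpNorm_lim_le_liminf_eLpNorm (p := 6)
    (fun n => (h1 (ns n)).continuous.aestronglyMeasurable (μ := volume)) u hae
  set C := SNormLESNormFDerivOfEqConst ℝ (volume : Measure R3) (2 : ℝ≥0)
  have hGNS : ∀ n, eLpNorm (φ n) 6 volume
      ≤ C * (eLpNorm (fun x => ∇ (φ n) x - g x) 2 volume + eLpNorm g 2 volume) := by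
    intro n
    -- Gagliardo-Nirenberg-Sobolev in dimension 3: `1/6 = 1/2 - 1/3`.
    have := eLpNorm_le_eLpNorm_fderiv_of_eq (volume : Measure R3) ((h1 n).of_le (by simp)) (h2 n)
      (p := 2) (p' := 6) one_le_two (by simp) (by simp; norm_num)
    refine this.trans (mul_le_mul_right ?_ _)
    have h5 : eLpNorm (fderiv ℝ (φ n)) 2 volume = eLpNorm (∇ (φ n)) 2 volume := by
      refine eLpNorm_congr_norm_ae (ae_of_all _ fun x => ?_)
      rw [gradient, LinearIsometryEquiv.norm_map]
    have h6 : ∇ (φ n) = (fun x => ∇ (φ n) x - g x) + g := by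
      ext1 x; simp
    rw [show ((2 : ℝ≥0) : ℝ≥0∞) = 2 from rfl, h5]
    nth_rw 1 [h6]
    exact eLpNorm_add_le ((contDiff_gradient (h1 n)).continuous.aestronglyMeasurable.sub hg.1)
      hg.1 one_le_two
  have hlt : ∀ᶠ n in atTop, eLpNorm (φ n) 6 volume ≤ C * (1 + eLpNorm g 2 volume) := by
    filter_upwards [h4.eventually (Iic_mem_nhds one_pos)] with n hn
    refine (hGNS n).trans ?_
    gcongr
  refine hF.trans_lt (lt_of_le_of_lt (b := C * (1 + eLpNorm g 2 volume)) ?_ ?_)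
  · exact (liminf_le_limsup).trans (limsup_le_of_le (h := hns.tendsto_atTop.eventually hlt))
  · exact ENNReal.mul_lt_top ENNReal.coe_lt_top (ENNReal.add_lt_top.2 ⟨ENNReal.one_lt_top, hg.2⟩)

/-! ### Integration by parts against radial vector fields. -/

section IntegrationByParts

theorem gradient_apply (k : R3 → ℝ) (x : R3) (i : Fin 3) :
    (∇ k x) i = fderiv ℝ k x (EuclideanSpace.single i 1) := by
  rw [← inner_gradient_left, EuclideanSpace.inner_single_right]
  simp

/-- The divergence theorem for `φ²V` with `V = k(x)(x - a)`, summed over coordinates; `3k + ⟪∇k, x -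
a⟫` is `div V`. -/
theorem integral_sq_mul_radial_of_contDiff {k φ : R3 → ℝ} (hk : ContDiff ℝ ∞ k)
    (hφ : ContDiff ℝ ∞ φ) (hφc : HasCompactSupport φ) (a : R3) :
    ∫ x, φ x * ((3 * k x + ⟪∇ k x, x - a⟫) * φ x) =
      -2 * ∫ x, φ x * (k x * ⟪∇ φ x, x - a⟫) := by
  let V : Fin 3 → R3 → ℝ := fun i x => k x * (x i - a i)
  let e : Fin 3 → R3 := fun i => EuclideanSpace.single i 1
  let p : R3 → ℝ := fun x => φ x * φ x
  have hV : ∀ i, ContDiff ℝ ∞ (V i) := fun i => by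
    have : ContDiff ℝ ∞ fun x : R3 => x i := by fun_prop
    exact hk.mul (this.sub contDiff_const)
  have hp : ContDiff ℝ ∞ p := hφ.mul hφ
  have hpc : HasCompactSupport p := hφc.mul_left
  have hdV : ∀ i x, fderiv ℝ (V i) x (e i) = k x + (∇ k x) i * (x i - a i) := by
    intro i x
    have h1 : HasFDerivAt (fun x : R3 => x i - a i) (EuclideanSpace.proj i : R3 →L[ℝ] ℝ) x :=
      (EuclideanSpace.proj i : R3 →L[ℝ] ℝ).hasFDerivAt.sub_const _
    have h2 := ((hk.differentiable (by simp)) x).hasFDerivAt.mul h1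
    have h3 : fderiv ℝ (V i) x = _ := h2.fderiv
    rw [h3, gradient_apply]
    simp [e]
    ring
  have hdp : ∀ i x, fderiv ℝ p x (e i) = 2 * φ x * (∇ φ x) i := by
    intro i x
    have h2 := ((hφ.differentiable (by simp)) x).hasFDerivAt
    have h3 : fderiv ℝ p x = _ := (h2.mul h2).fderiv
    rw [h3, gradient_apply]
    simp [e]
    ring
  have cp := hp.continuous
  have cV := fun i => (hV i).continuous
  have cdp : ∀ i, Continuous fun x => fderiv ℝ p x (e i) := fun i =>
    (hp.continuous_fderiv (by simp)).clm_apply continuous_const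
  have cdV : ∀ i, Continuous fun x => fderiv ℝ (V i) x (e i) := fun i =>
    ((hV i).continuous_fderiv (by simp)).clm_apply continuous_const
  have sdp : ∀ i, HasCompactSupport fun x => fderiv ℝ p x (e i) := fun i => hpc.fderiv_apply ℝ (e i)
  have i1 : ∀ i, Integrable (fun x => fderiv ℝ p x (e i) * V i x) volume := fun i =>
    ((cdp i).mul (cV i)).integrable_of_hasCompactSupport (sdp i).mul_right
  have i2 : ∀ i, Integrable (fun x => p x * fderiv ℝ (V i) x (e i)) volume := fun i =>
    (cp.mul (cdV i)).integrable_of_hasCompactSupport hpc.mul_right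
  have i3 : ∀ i, Integrable (fun x => p x * V i x) volume := fun i =>
    (cp.mul (cV i)).integrable_of_hasCompactSupport hpc.mul_right
  have main : ∀ i, ∫ x, p x * fderiv ℝ (V i) x (e i) = - ∫ x, fderiv ℝ p x (e i) * V i x :=
    fun i => integral_mul_fderiv_eq_neg_fderiv_mul_of_integrable (i1 i) (i2 i) (i3 i)
      (fun x _ => (hp.differentiable (by simp)) x) (fun x _ => ((hV i).differentiable (by simp)) x)
  have hsum := Finset.sum_congr (rfl : (Finset.univ : Finset (Fin 3)) = _) fun i _ => main i
  rw [Finset.sum_neg_distrib, ← integral_finsetSum _ fun i _ => i2 i,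
    ← integral_finsetSum _ fun i _ => i1 i] at hsum
  have e1 : ∀ x, ∑ i, p x * fderiv ℝ (V i) x (e i)
      = φ x * ((3 * k x + ⟪∇ k x, x - a⟫) * φ x) := by
    intro x
    simp only [hdV, PiLp.inner_apply, Fin.sum_univ_three, p]
    simp
    ring
  have e2 : ∀ x, ∑ i, fderiv ℝ p x (e i) * V i x = 2 * (φ x * (k x * ⟪∇ φ x, x - a⟫)) := by
    intro x
    simp only [hdp, PiLp.inner_apply, Fin.sum_univ_three, V]
    simp
    ring
  simp_rw [e1, e2] at hsum
  rw [hsum, integral_const_mul]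
  ring

/-- Integration by parts of `u²` against the bounded radial vector field `k(x)(x - a)`. -/
theorem HasWeakGradient.integral_sq_mul_radial {u : R3 → ℝ} {g : R3 → R3}
    (h : HasWeakGradient u g) (hu : MemLp u 2 volume) (hg : MemLp g 2 volume)
    {k : R3 → ℝ} (hk : ContDiff ℝ ∞ k) (a : R3) {C : ℝ}
    (hC1 : ∀ x, |k x| * ‖x - a‖ ≤ C) (hC2 : ∀ x, |3 * k x + ⟪∇ k x, x - a⟫| ≤ C) :
    ∫ x, u x * ((3 * k x + ⟪∇ k x, x - a⟫) * u x) = -2 * ∫ x, u x * (k x * ⟪g x, x - a⟫) := by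
  obtain ⟨φ, h1, h2, h3, h4⟩ := exists_smooth_seq h hu hg
  have cD : Continuous fun x => 3 * k x + ⟪∇ k x, x - a⟫ :=
    (continuous_const.mul hk.continuous).add
      ((contDiff_gradient hk).continuous.inner (continuous_id.sub continuous_const))
  have mD : ∀ {v : R3 → ℝ}, MemLp v 2 volume →
      MemLp (fun x => (3 * k x + ⟪∇ k x, x - a⟫) * v x) 2 volume := fun {v} hv =>
    hv.of_le_mul (c := C) (cD.aestronglyMeasurable.mul hv.1) (ae_of_all _ fun x => by
      rw [norm_mul]
      exact mul_le_mul_of_nonneg_right (hC2 x) (norm_nonneg _))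
  have bV : ∀ (w : R3) x, ‖k x * ⟪w, x - a⟫‖ ≤ C * ‖w‖ := fun w x => by
    rw [norm_mul]
    calc ‖k x‖ * ‖⟪w, x - a⟫‖ ≤ |k x| * (‖w‖ * ‖x - a‖) :=
          mul_le_mul_of_nonneg_left (norm_inner_le_norm _ _) (abs_nonneg _)
      _ = |k x| * ‖x - a‖ * ‖w‖ := by ring
      _ ≤ C * ‖w‖ := mul_le_mul_of_nonneg_right (hC1 x) (norm_nonneg _)
  have mV : ∀ {w : R3 → R3}, MemLp w 2 volume →
      MemLp (fun x => k x * ⟪w x, x - a⟫) 2 volume := fun {w} hw =>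
    hw.of_le_mul (c := C) (hk.continuous.aestronglyMeasurable.mul
      (hw.1.inner (continuous_id.sub continuous_const).aestronglyMeasurable))
      (ae_of_all _ fun x => bV _ x)
  have mφ : ∀ n, MemLp (φ n) 2 volume := fun n =>
    (h1 n).continuous.memLp_of_hasCompactSupport (h2 n)
  have mg : ∀ n, MemLp (∇ (φ n)) 2 volume := fun n =>
    (contDiff_gradient (h1 n)).continuous.memLp_of_hasCompactSupport
      (hasCompactSupport_gradient (h2 n))
  have lim0 : ∀ {f : ℕ → ℝ≥0∞}, Tendsto f atTop (𝓝 0) →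
      Tendsto (fun n => ENNReal.ofReal C * f n) atTop (𝓝 0) := fun hf => by
    simpa using ENNReal.Tendsto.const_mul hf (Or.inr ENNReal.ofReal_ne_top)
  have t1 : Tendsto (fun n => eLpNorm (fun x => (3 * k x + ⟪∇ k x, x - a⟫) * φ n x -
      (3 * k x + ⟪∇ k x, x - a⟫) * u x) 2 volume) atTop (𝓝 0) := by
    refine tendsto_of_tendsto_of_tendsto_of_le_of_le tendsto_const_nhds (lim0 h3)
      (fun _ => zero_le) fun n => ?_
    refine eLpNorm_le_mul_eLpNorm_of_ae_le_mul (ae_of_all _ fun x => ?_) 2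
    rw [← mul_sub, norm_mul]
    exact mul_le_mul_of_nonneg_right (hC2 x) (norm_nonneg _)
  have t2 : Tendsto (fun n => eLpNorm (fun x => k x * ⟪∇ (φ n) x, x - a⟫ -
      k x * ⟪g x, x - a⟫) 2 volume) atTop (𝓝 0) := by
    refine tendsto_of_tendsto_of_tendsto_of_le_of_le tendsto_const_nhds (lim0 h4)
      (fun _ => zero_le) fun n => ?_
    refine eLpNorm_le_mul_eLpNorm_of_ae_le_mul (ae_of_all _ fun x => ?_) 2
    rw [← mul_sub, ← inner_sub_left]
    exact bV _ x
  have l1 := tendsto_integral_mul_of_tendsto_eLpNorm mφ (fun n => mD (mφ n)) hu (mD hu) h3 t1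
  have l2 := tendsto_integral_mul_of_tendsto_eLpNorm mφ (fun n => mV (mg n)) hu (mV hg) h3 t2
  simp_rw [fun n => integral_sq_mul_radial_of_contDiff hk (h1 n) (h2 n) a] at l1
  exact tendsto_nhds_unique l1 (l2.const_mul (-2))

end IntegrationByParts

/-! ### The regularized weight and its derivatives. -/

noncomputable section

/-- The regularized distance `√(|x - a|² + δ²)`. -/
def regDist (δ : ℝ) (a x : R3) : ℝ := Real.sqrt (‖x - a‖ ^ 2 + δ ^ 2)

/-- The bounded smooth weight `s / (1 + ε s)`, `s` the regularized distance. -/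
def weight (δ ε : ℝ) (a x : R3) : ℝ := regDist δ a x / (1 + ε * regDist δ a x)

/-- The radial profile of the gradient of `weight`: `1 / (s (1 + ε s)²)`. -/
def weightProfile (δ ε : ℝ) (a x : R3) : ℝ :=
  (regDist δ a x)⁻¹ * ((1 + ε * regDist δ a x)⁻¹) ^ 2

variable {δ ε : ℝ} (a x : R3)

theorem regDist_sq : regDist δ a x ^ 2 = ‖x - a‖ ^ 2 + δ ^ 2 := Real.sq_sqrt (by positivity)

theorem regDist_pos (hδ : 0 < δ) : 0 < regDist δ a x := Real.sqrt_pos.2 (by positivity)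

theorem norm_sub_le_regDist : ‖x - a‖ ≤ regDist δ a x :=
  Real.le_sqrt_of_sq_le (by nlinarith [sq_nonneg δ])

theorem le_regDist : δ ≤ regDist δ a x :=
  Real.le_sqrt_of_sq_le (by nlinarith [sq_nonneg ‖x - a‖])

theorem regDist_le (hδ : 0 ≤ δ) : regDist δ a x ≤ ‖x - a‖ + δ :=
  Real.sqrt_le_iff.2 ⟨by positivity, by nlinarith [norm_nonneg (x - a)]⟩

theorem one_le_one_add_mul_regDist (hε : 0 ≤ ε) : 1 ≤ 1 + ε * regDist δ a x := by
  have : 0 ≤ ε * regDist δ a x := mul_nonneg hε (Real.sqrt_nonneg _)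
  linarith

theorem contDiff_regDist (hδ : 0 < δ) : ContDiff ℝ ∞ (regDist δ a) := by
  have h : ContDiff ℝ ∞ fun x : R3 => ‖x - a‖ ^ 2 + δ ^ 2 :=
    ((contDiff_id.sub contDiff_const).norm_sq ℝ).add contDiff_const
  exact h.sqrt fun x => by positivity

theorem contDiff_weight (hδ : 0 < δ) (hε : 0 ≤ ε) : ContDiff ℝ ∞ (weight δ ε a) :=
  (contDiff_regDist a hδ).div (contDiff_const.add (contDiff_const.mul (contDiff_regDist a hδ)))
    fun x => (one_pos.trans_le (one_le_one_add_mul_regDist a x hε)).ne'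

theorem contDiff_weightProfile (hδ : 0 < δ) (hε : 0 ≤ ε) :
    ContDiff ℝ ∞ (weightProfile δ ε a) :=
  ((contDiff_regDist a hδ).inv fun x => (regDist_pos a x hδ).ne').mul
    (((contDiff_const.add (contDiff_const.mul (contDiff_regDist a hδ))).inv
    fun x => (one_pos.trans_le (one_le_one_add_mul_regDist a x hε)).ne').pow 2)

theorem hasFDerivAt_regDist (hδ : 0 < δ) :
    HasFDerivAt (regDist δ a) ((regDist δ a x)⁻¹ • innerSL ℝ (x - a)) x := by
  have h1 : HasFDerivAt (fun x : R3 => ‖x - a‖ ^ 2 + δ ^ 2) (2 • innerSL ℝ (x - a)) x := by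
    have := ((hasFDerivAt_id x).sub_const a).norm_sq
    simpa using this.add_const (δ ^ 2)
  have h2 := h1.sqrt (by positivity : ‖x - a‖ ^ 2 + δ ^ 2 ≠ 0)
  refine h2.congr_fderiv ?_
  ext v
  simp [regDist]
  ring

theorem gradient_weight (hδ : 0 < δ) (hε : 0 ≤ ε) :
    ∇ (weight δ ε a) x = weightProfile δ ε a x • (x - a) := by
  have hs := regDist_pos a x hδ
  have hb := one_pos.trans_le (one_le_one_add_mul_regDist (δ := δ) a x hε)
  have h1 : HasDerivAt (fun s : ℝ => s / (1 + ε * s))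
      (((1 + ε * regDist δ a x)⁻¹) ^ 2) (regDist δ a x) := by
    have := (hasDerivAt_id (regDist δ a x)).div
      (((hasDerivAt_id (regDist δ a x)).const_mul ε).const_add 1) hb.ne'
    refine this.congr_deriv ?_
    simp only [id]
    field_simp
    ring
  have h2 : HasFDerivAt (weight δ ε a) _ x := h1.comp_hasFDerivAt x (hasFDerivAt_regDist a x hδ)
  refine ext_inner_right ℝ fun v => ?_
  rw [inner_gradient_left, h2.fderiv, inner_smul_left]
  have h3 : (innerSL ℝ (x - a)) v = ⟪x - a, v⟫ := rfl
  simp only [_root_.smul_apply, smul_eq_mul, h3, weightProfile, conj_trivial]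
  ring

/-- By `gradient_weight`, the left side is the Laplacian of `weight`. -/
theorem divergence_weightProfile (hδ : 0 < δ) (hε : 0 ≤ ε) :
    3 * weightProfile δ ε a x + ⟪∇ (weightProfile δ ε a) x, x - a⟫ =
      (3 * δ ^ 2 * (1 + ε * regDist δ a x) + 2 * ‖x - a‖ ^ 2) /
        (regDist δ a x ^ 3 * (1 + ε * regDist δ a x) ^ 3) := by
  have hs := regDist_pos a x hδ
  have hb := one_pos.trans_le (one_le_one_add_mul_regDist (δ := δ) a x hε)
  have hsq := regDist_sq (δ := δ) a x
  have h1 : HasDerivAt (fun s : ℝ => s⁻¹ * ((1 + ε * s)⁻¹) ^ 2)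
      (-(1 + 3 * ε * regDist δ a x) / (regDist δ a x ^ 2 * (1 + ε * regDist δ a x) ^ 3))
      (regDist δ a x) := by
    have := (hasDerivAt_inv hs.ne').mul
      (((((hasDerivAt_id (regDist δ a x)).const_mul ε).const_add 1).inv hb.ne').pow 2)
    refine this.congr_deriv ?_
    simp only [id, Pi.inv_apply, Pi.pow_apply, Nat.cast_ofNat, Nat.reduceSub, pow_one]
    field_simp
    ring
  have h2 : HasFDerivAt (weightProfile δ ε a) _ x :=
    h1.comp_hasFDerivAt x (hasFDerivAt_regDist a x hδ)
  rw [inner_gradient_left, h2.fderiv]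
  have h3 : (innerSL ℝ (x - a)) (x - a) = ‖x - a‖ ^ 2 := by
    rw [innerSL_apply_apply, real_inner_self_eq_norm_sq]
  simp only [_root_.smul_apply, smul_eq_mul, h3, weightProfile]
  have hr : δ ^ 2 = regDist δ a x ^ 2 - ‖x - a‖ ^ 2 := by linarith
  rw [hr]
  field_simp
  ring

theorem weightProfile_nonneg (hδ : 0 < δ) : 0 ≤ weightProfile δ ε a x :=
  mul_nonneg (inv_nonneg.2 (regDist_pos a x hδ).le) (sq_nonneg _)

/-- This bounds `|∇η|` by 1, which makes the field admissible for integration by parts and keeps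
`ηu` in `H¹`. -/
theorem weightProfile_mul_norm_le (hδ : 0 < δ) (hε : 0 ≤ ε) :
    weightProfile δ ε a x * ‖x - a‖ ≤ 1 := by
  have hs := regDist_pos a x hδ
  have hb := one_le_one_add_mul_regDist (δ := δ) a x hε
  calc weightProfile δ ε a x * ‖x - a‖
      = (regDist δ a x)⁻¹ * ‖x - a‖ * ((1 + ε * regDist δ a x)⁻¹) ^ 2 := by
        unfold weightProfile; ring
    _ ≤ 1 * 1 := by
        refine mul_le_mul ?_ ?_ (by positivity) zero_le_one
        · rw [inv_mul_le_one₀ hs]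
          exact norm_sub_le_regDist a x
        · exact pow_le_one₀ (by positivity) (inv_le_one_of_one_le₀ hb)
    _ = 1 := one_mul 1

theorem divergence_weightProfile_nonneg (hδ : 0 < δ) (hε : 0 ≤ ε) :
    0 ≤ 3 * weightProfile δ ε a x + ⟪∇ (weightProfile δ ε a) x, x - a⟫ := by
  have hs := regDist_pos a x hδ
  have hb := one_pos.trans_le (one_le_one_add_mul_regDist (δ := δ) a x hε)
  rw [divergence_weightProfile a x hδ hε]
  positivity

theorem divergence_weightProfile_le (hδ : 0 < δ) (hε : 0 ≤ ε) :
    3 * weightProfile δ ε a x + ⟪∇ (weightProfile δ ε a) x, x - a⟫ ≤ 3 / δ := by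
  have hs := regDist_pos a x hδ
  have hb := one_le_one_add_mul_regDist (δ := δ) a x hε
  have hsq := regDist_sq (δ := δ) a x
  have hδs := le_regDist (δ := δ) a x
  rw [divergence_weightProfile a x hδ hε]
  set s := regDist δ a x
  set b := 1 + ε * s
  calc (3 * δ ^ 2 * b + 2 * ‖x - a‖ ^ 2) / (s ^ 3 * b ^ 3)
      ≤ (3 * s ^ 2 * b ^ 3) / (s ^ 3 * b ^ 3) := by
        refine div_le_div_of_nonneg_right ?_ (by positivity)
        have h1 : b ≤ b ^ 3 := le_self_pow₀ hb (by norm_num)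
        have h2 : 1 ≤ b ^ 3 := hb.trans h1
        rw [hsq]
        nlinarith [mul_le_mul_of_nonneg_left h1 (sq_nonneg δ),
          mul_le_mul_of_nonneg_left h2 (sq_nonneg ‖x - a‖)]
    _ = 3 / s := by field_simp
    _ ≤ 3 / δ := by gcongr

/-- The reciprocal of `weight` is superharmonic. -/
theorem two_mul_weightProfile_sq_le (hδ : 0 < δ) (hε : 0 ≤ ε) :
    2 * (weightProfile δ ε a x ^ 2 * ‖x - a‖ ^ 2) ≤
      weight δ ε a x * (3 * weightProfile δ ε a x + ⟪∇ (weightProfile δ ε a) x, x - a⟫) := by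
  have hs := regDist_pos a x hδ
  have hb := one_pos.trans_le (one_le_one_add_mul_regDist (δ := δ) a x hε)
  rw [divergence_weightProfile a x hδ hε]
  unfold weight weightProfile
  set s := regDist δ a x
  set b := 1 + ε * s
  have h1 : 2 * ((s⁻¹ * b⁻¹ ^ 2) ^ 2 * ‖x - a‖ ^ 2) = (2 * ‖x - a‖ ^ 2) / (s ^ 2 * b ^ 4) := by
    field_simp
  have h2 : s / b * ((3 * δ ^ 2 * b + 2 * ‖x - a‖ ^ 2) / (s ^ 3 * b ^ 3))
      = (3 * δ ^ 2 * b + 2 * ‖x - a‖ ^ 2) / (s ^ 2 * b ^ 4) := by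
    field_simp
  rw [h1, h2]
  -- Over the common denominator the two sides differ only by `3δ²b ≥ 0`.
  refine div_le_div_of_nonneg_right ?_ (by positivity)
  have : 0 ≤ 3 * δ ^ 2 * b := by positivity
  linarith

theorem two_div_regDist_le (hδ : 0 < δ) :
    2 / regDist δ a x ≤
      3 * weightProfile δ 0 a x + ⟪∇ (weightProfile δ 0 a) x, x - a⟫ := by
  have hs := regDist_pos a x hδ
  have hsq := regDist_sq (δ := δ) a x
  rw [divergence_weightProfile a x hδ le_rfl, div_le_div_iff₀ hs (by positivity)]
  set s := regDist δ a x
  have : 2 * s ^ 2 ≤ 3 * δ ^ 2 + 2 * ‖x - a‖ ^ 2 := by nlinarith [sq_nonneg δ]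
  nlinarith

/-! ### Hardy inequality and positivity of the weighted kinetic term. -/

variable {u : R3 → ℝ} {g : R3 → R3}

theorem HasWeakGradient.integral_sq_mul_weightProfile (h : HasWeakGradient u g)
    (hu : MemLp u 2 volume) (hg : MemLp g 2 volume) (hδ : 0 < δ) (hε : 0 ≤ ε) :
    ∫ x, u x * ((3 * weightProfile δ ε a x + ⟪∇ (weightProfile δ ε a) x, x - a⟫) * u x) =
      -2 * ∫ x, u x * (weightProfile δ ε a x * ⟪g x, x - a⟫) := by
  refine h.integral_sq_mul_radial hu hg (contDiff_weightProfile a hδ hε) a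
    (C := max 1 (3 / δ)) (fun x => ?_) (fun x => ?_)
  · rw [abs_of_nonneg (weightProfile_nonneg a x hδ)]
    exact (weightProfile_mul_norm_le a x hδ hε).trans (le_max_left _ _)
  · rw [abs_of_nonneg (divergence_weightProfile_nonneg a x hδ hε)]
    exact (divergence_weightProfile_le a x hδ hε).trans (le_max_right _ _)

theorem abs_weightProfile_mul_inner_le (hδ : 0 < δ) (hε : 0 ≤ ε) (w : R3) :
    |weightProfile δ ε a x * ⟪w, x - a⟫| ≤ ‖w‖ := by
  rw [abs_mul, abs_of_nonneg (weightProfile_nonneg a x hδ)]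
  calc _ ≤ weightProfile δ ε a x * (‖w‖ * ‖x - a‖) :=
        mul_le_mul_of_nonneg_left (abs_real_inner_le_norm _ _) (weightProfile_nonneg a x hδ)
    _ = weightProfile δ ε a x * ‖x - a‖ * ‖w‖ := by ring
    _ ≤ 1 * ‖w‖ := mul_le_mul_of_nonneg_right (weightProfile_mul_norm_le a x hδ hε) (norm_nonneg _)
    _ = ‖w‖ := one_mul _

theorem integrable_mul_weightProfile (hu : MemLp u 2 volume) (hg : MemLp g 2 volume)
    (hδ : 0 < δ) (hε : 0 ≤ ε) :
    Integrable (fun x => u x * (weightProfile δ ε a x * ⟪g x, x - a⟫)) volume := by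
  have : MemLp (fun x => weightProfile δ ε a x * ⟪g x, x - a⟫) 2 volume :=
    hg.of_le ((contDiff_weightProfile a hδ hε).continuous.aestronglyMeasurable.mul
      (hg.1.inner (continuous_id.sub continuous_const).aestronglyMeasurable))
      (ae_of_all _ fun x => abs_weightProfile_mul_inner_le a x hδ hε (g x))
  exact hu.integrable_mul this

theorem integrable_sq_mul_divergence (hu : MemLp u 2 volume) (hδ : 0 < δ) (hε : 0 ≤ ε) :
    Integrable (fun x => u x *
      ((3 * weightProfile δ ε a x + ⟪∇ (weightProfile δ ε a) x, x - a⟫) * u x)) volume := by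
  have hk := contDiff_weightProfile a hδ hε
  have cD : Continuous fun x => 3 * weightProfile δ ε a x + ⟪∇ (weightProfile δ ε a) x, x - a⟫ :=
    (continuous_const.mul hk.continuous).add
      ((contDiff_gradient hk).continuous.inner (continuous_id.sub continuous_const))
  refine hu.integrable_mul (hu.of_le_mul (c := 3 / δ) (cD.aestronglyMeasurable.mul hu.1)
    (ae_of_all _ fun x => ?_))
  rw [norm_mul, Real.norm_of_nonneg (divergence_weightProfile_nonneg a x hδ hε)]
  exact mul_le_mul_of_nonneg_right (divergence_weightProfile_le a x hδ hε) (norm_nonneg _)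

/-- With `ε = 0` the divergence dominates `2/s`, while the field has length at most 1. Integrating
by parts bounds `2∫ u²/s` by `2∫ |u||g|`, independently of `δ` and `a`; Fatou then allows `δ → 0`.
-/
theorem HasWeakGradient.integral_sq_div_regDist_le (h : HasWeakGradient u g)
    (hu : MemLp u 2 volume) (hg : MemLp g 2 volume) (hδ : 0 < δ) :
    Integrable (fun x => u x ^ 2 / regDist δ a x) volume ∧
    ∫ x, u x ^ 2 / regDist δ a x ≤ 1 / 2 * ∫ x, (u x ^ 2 + ‖g x‖ ^ 2) := by
  have hi := integrable_sq_mul_divergence a hu hδ le_rfl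
  have hp : ∀ x, 2 * (u x ^ 2 / regDist δ a x) ≤
      u x * ((3 * weightProfile δ 0 a x + ⟪∇ (weightProfile δ 0 a) x, x - a⟫) * u x) := fun x => by
    have := mul_le_mul_of_nonneg_right (two_div_regDist_le a x hδ) (sq_nonneg (u x))
    calc _ = 2 / regDist δ a x * u x ^ 2 := by ring
      _ ≤ _ := this
      _ = _ := by ring
  have hint : Integrable (fun x => u x ^ 2 / regDist δ a x) volume := by
    refine hi.mono' ((hu.1.pow 2).div₀ (contDiff_regDist a hδ).continuous.aestronglyMeasurable
      ) (ae_of_all _ fun x => ?_)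
    have h0 : 0 ≤ u x ^ 2 / regDist δ a x := div_nonneg (sq_nonneg _) (regDist_pos a x hδ).le
    rw [Real.norm_of_nonneg h0]
    linarith [hp x]
  refine ⟨hint, ?_⟩
  have h1 := integral_mono (hint.const_mul 2) hi hp
  rw [integral_const_mul, h.integral_sq_mul_weightProfile a hu hg hδ le_rfl] at h1
  have h2 : -(2 * ∫ x, u x * (weightProfile δ 0 a x * ⟪g x, x - a⟫))
      ≤ ∫ x, (u x ^ 2 + ‖g x‖ ^ 2) := by
    rw [← integral_const_mul, ← integral_neg]
    refine integral_mono ((integrable_mul_weightProfile a hu hg hδ le_rfl).const_mul 2).neg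
      (hu.integrable_sq.add hg.norm.integrable_sq) fun x => ?_
    have h3 := abs_weightProfile_mul_inner_le a x hδ le_rfl (g x)
    have h4 : |u x| * |weightProfile δ 0 a x * ⟪g x, x - a⟫| ≤ |u x| * ‖g x‖ :=
      mul_le_mul_of_nonneg_left h3 (abs_nonneg _)
    rw [← abs_mul] at h4
    have h5 := neg_abs_le (u x * (weightProfile δ 0 a x * ⟪g x, x - a⟫))
    have h6 := two_mul_le_add_sq |u x| ‖g x‖
    rw [sq_abs] at h6
    dsimp only
    linarith
  linarith

/-- A Hardy inequality: `∫ u² / |x - a| ≤ ½ ‖u‖²_{H¹}`, uniformly in `a`. -/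
theorem HasWeakGradient.integral_sq_div_norm_le (h : HasWeakGradient u g)
    (hu : MemLp u 2 volume) (hg : MemLp g 2 volume) :
    Integrable (fun x => u x ^ 2 / ‖x - a‖) volume ∧
    ∫ x, u x ^ 2 / ‖x - a‖ ≤ 1 / 2 * ∫ x, (u x ^ 2 + ‖g x‖ ^ 2) := by
  set K := 1 / 2 * ∫ x, (u x ^ 2 + ‖g x‖ ^ 2)
  let d : ℕ → ℝ := fun n => 1 / ((n : ℝ) + 1)
  have hd : ∀ n, 0 < d n := fun n => by positivity
  have hd0 : Tendsto d atTop (𝓝 0) := tendsto_one_div_add_atTop_nhds_zero_nat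
  have hK : 0 ≤ K := by positivity
  have hnn : ∀ x, 0 ≤ u x ^ 2 / ‖x - a‖ := fun x => by positivity
  have hmeas : AEStronglyMeasurable (fun x => u x ^ 2 / ‖x - a‖) volume :=
    (hu.1.pow 2).div₀ (by fun_prop)
  have hle : ∀ n, ∫⁻ x, ENNReal.ofReal (u x ^ 2 / regDist (d n) a x) ≤ ENNReal.ofReal K := by
    intro n
    obtain ⟨h1, h2⟩ := h.integral_sq_div_regDist_le a hu hg (hd n)
    rw [← ofReal_integral_eq_lintegral_ofReal h1
      (ae_of_all _ fun x => div_nonneg (sq_nonneg _) (regDist_pos a x (hd n)).le)]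
    exact ENNReal.ofReal_le_ofReal h2
  have hlim : ∫⁻ x, ENNReal.ofReal (u x ^ 2 / ‖x - a‖) ≤ ENNReal.ofReal K := by
    calc ∫⁻ x, ENNReal.ofReal (u x ^ 2 / ‖x - a‖)
        = ∫⁻ x, liminf (fun n => ENNReal.ofReal (u x ^ 2 / regDist (d n) a x)) atTop := by
          refine lintegral_congr_ae ?_
          have hne : ∀ᵐ x : R3, x ≠ a := by simp [ae_iff]
          filter_upwards [hne] with x hx
          have h1 : Tendsto (fun n => regDist (d n) a x) atTop (𝓝 ‖x - a‖) := by
            have := ((hd0.pow 2).const_add (‖x - a‖ ^ 2)).sqrt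
            simpa [regDist] using this
          have h2 := (tendsto_const_nhds (x := u x ^ 2)).div h1 (norm_ne_zero_iff.2 (sub_ne_zero.2 hx))
          exact ((ENNReal.tendsto_ofReal h2).liminf_eq).symm
      _ ≤ liminf (fun n => ∫⁻ x, ENNReal.ofReal (u x ^ 2 / regDist (d n) a x)) atTop :=
          lintegral_liminf_le' fun n =>
            ((hu.1.pow 2).div₀ (contDiff_regDist a (hd n)).continuous.aestronglyMeasurable
              ).aemeasurable.ennreal_ofReal
      _ ≤ ENNReal.ofReal K :=
          le_trans liminf_le_limsup (limsup_le_of_le (h := Eventually.of_forall hle))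
  have hint : Integrable (fun x => u x ^ 2 / ‖x - a‖) volume :=
    ⟨hmeas, (hasFiniteIntegral_iff_ofReal (ae_of_all _ hnn)).2
      (hlim.trans_lt ENNReal.ofReal_lt_top)⟩
  refine ⟨hint, ?_⟩
  rw [← ofReal_integral_eq_lintegral_ofReal hint (ae_of_all _ hnn)] at hlim
  exact (ENNReal.ofReal_le_ofReal_iff hK).1 hlim

theorem weight_nonneg (hδ : 0 < δ) (hε : 0 ≤ ε) : 0 ≤ weight δ ε a x :=
  div_nonneg (regDist_pos a x hδ).le
    (zero_le_one.trans (one_le_one_add_mul_regDist a x hε))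

theorem weight_pos (hδ : 0 < δ) (hε : 0 ≤ ε) : 0 < weight δ ε a x :=
  div_pos (regDist_pos a x hδ) (one_pos.trans_le (one_le_one_add_mul_regDist a x hε))

theorem weight_le (hδ : 0 < δ) (hε : 0 < ε) : weight δ ε a x ≤ 1 / ε := by
  have hs := regDist_pos a x hδ
  unfold weight
  rw [div_le_div_iff₀ (by positivity) hε]
  nlinarith

theorem weight_le_regDist (hδ : 0 < δ) (hε : 0 ≤ ε) : weight δ ε a x ≤ regDist δ a x :=
  div_le_self (regDist_pos a x hδ).le (one_le_one_add_mul_regDist a x hε)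

theorem integrable_weight_mul (hu : MemLp u 2 volume) (hg : MemLp g 2 volume)
    (hδ : 0 < δ) (hε : 0 < ε) :
    Integrable (fun x => weight δ ε a x * ‖g x‖ ^ 2 +
      u x * (weightProfile δ ε a x * ⟪g x, x - a⟫)) volume := by
  refine Integrable.add ?_ (integrable_mul_weightProfile a hu hg hδ hε.le)
  refine hg.norm.integrable_sq.bdd_mul (c := 1 / ε)
    (contDiff_weight a hδ hε.le).continuous.aestronglyMeasurable (ae_of_all _ fun x => ?_)
  rw [Real.norm_of_nonneg (weight_nonneg a x hδ hε.le)]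
  exact weight_le a x hδ hε

/-- Lieb's positivity `∫ ∇u · ∇(η u) ≥ 0` for the weight `η`. -/
theorem HasWeakGradient.integral_weight_mul_nonneg (h : HasWeakGradient u g)
    (hu : MemLp u 2 volume) (hg : MemLp g 2 volume) (hδ : 0 < δ) (hε : 0 < ε) :
    0 ≤ ∫ x, (weight δ ε a x * ‖g x‖ ^ 2 +
      u x * (weightProfile δ ε a x * ⟪g x, x - a⟫)) := by
  have i1 := integrable_mul_weightProfile a hu hg hδ hε.le
  have i2 := integrable_sq_mul_divergence a hu hδ hε.le
  have h0 := h.integral_sq_mul_weightProfile a hu hg hδ hε.le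
  have i3 : Integrable (fun x => -(u x * (weightProfile δ ε a x * ⟪g x, x - a⟫))) volume := i1.neg
  -- Integration by parts provides a comparison function of zero integral; it suffices to bound the
  -- integrand below by it pointwise.
  have hz : ∫ x, (-(u x * (weightProfile δ ε a x * ⟪g x, x - a⟫)) - 1 / 2 * (u x *
      ((3 * weightProfile δ ε a x + ⟪∇ (weightProfile δ ε a) x, x - a⟫) * u x))) = 0 := by
    rw [integral_sub i3 (i2.const_mul _), integral_neg, integral_const_mul, h0]
    ring
  rw [← hz]
  refine integral_mono (i3.sub (i2.const_mul _)) (integrable_weight_mul a hu hg hδ hε)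
    fun x => ?_
  have hw := weight_pos a x hδ hε.le
  have hsup := two_mul_weightProfile_sq_le a x hδ hε.le
  dsimp only
  set η := weight δ ε a x
  set κ := weightProfile δ ε a x
  set D := 3 * κ + ⟪∇ (weightProfile δ ε a) x, x - a⟫
  -- After multiplication by `η` the difference is this square, up to replacing `κ²|x-a|²` by the
  -- larger `ηD/2` (superharmonicity of `1/η`).
  have hsq : 0 ≤ ‖η • g x + (u x * κ) • (x - a)‖ ^ 2 := sq_nonneg _
  rw [norm_add_sq_real, norm_smul, norm_smul, mul_pow, mul_pow, inner_smul_left, inner_smul_right,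
    Real.norm_eq_abs, Real.norm_eq_abs, sq_abs, sq_abs] at hsq
  simp only [conj_trivial] at hsq
  have h1 := mul_le_mul_of_nonneg_left hsup (sq_nonneg (u x))
  have h2 : 0 ≤ η * (η * ‖g x‖ ^ 2 + 2 * (u x * (κ * ⟪g x, x - a⟫)) + 1 / 2 * (u x * (D * u x))) := by
    nlinarith
  have h3 := nonneg_of_mul_nonneg_right h2 hw
  linarith

end

/-! ### Finiteness and splitting of the energy. -/

section Energy

variable {v : R3 → ℝ} {k : R3 → R3}

/-- For `w = v²` the right side is `v² + v⁶`, controlled by `L²` and `L⁶`. -/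
theorem rpow_five_thirds_le {w : ℝ} (hw : 0 ≤ w) : w ^ (5 / 3 : ℝ) ≤ w + w ^ 3 := by
  rcases le_total w 1 with h | h
  · have := Real.rpow_le_rpow_of_exponent_ge_of_imp hw h (by norm_num : (1 : ℝ) ≤ 5 / 3)
      (fun _ h => absurd h (by norm_num))
    rw [Real.rpow_one] at this
    exact this.trans (le_add_of_nonneg_right (by positivity))
  · have := Real.rpow_le_rpow_of_exponent_le h (by norm_num : (5 / 3 : ℝ) ≤ (3 : ℕ))
    rw [Real.rpow_natCast] at this
    exact this.trans (le_add_of_nonneg_left hw)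

theorem HasWeakGradient.integrable_sq_rpow (h : HasWeakGradient v k) (hv : MemLp v 2 volume)
    (hk : MemLp k 2 volume) : Integrable (fun x => (v x ^ 2) ^ (5 / 3 : ℝ)) volume := by
  have h6 : Integrable (fun x => ‖v x‖ ^ 6) volume :=
    (h.memLp_six hv hk).integrable_norm_pow (p := 6) (by norm_num)
  refine (hv.integrable_sq.add h6).mono'
    ((hv.1.aemeasurable.pow_const 2).pow_const _).aestronglyMeasurable (ae_of_all _ fun x => ?_)
  rw [Real.norm_of_nonneg (by positivity)]
  refine (rpow_five_thirds_le (sq_nonneg (v x))).trans (le_of_eq ?_)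
  simp only [Pi.add_apply, Real.norm_eq_abs]
  rw [← pow_mul, ← (by decide : Even 6).pow_abs (v x)]

/-- The Hardy bound is uniform in the centre, so the potential of `v²` is bounded and may be
integrated against `v²`. -/
theorem HasWeakGradient.integrable_coulomb (h : HasWeakGradient v k) (hv : MemLp v 2 volume)
    (hk : MemLp k 2 volume) :
    Integrable (fun p : R3 × R3 => v p.1 ^ 2 * v p.2 ^ 2 / ‖p.1 - p.2‖)
      ((volume : Measure R3).prod volume) := by
  have hm : AEStronglyMeasurable (fun p : R3 × R3 => v p.1 ^ 2 * v p.2 ^ 2 / ‖p.1 - p.2‖)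
      ((volume : Measure R3).prod volume) :=
    ((hv.1.comp_fst.pow 2).mul (hv.1.comp_snd.pow 2)).div₀ (by fun_prop)
  have hy : ∀ x y : R3, v x ^ 2 * v y ^ 2 / ‖x - y‖ = v x ^ 2 * (v y ^ 2 / ‖y - x‖) := by
    intro x y
    rw [norm_sub_rev, mul_div_assoc]
  refine (integrable_prod_iff hm).2 ⟨ae_of_all _ fun x => ?_, ?_⟩
  · simp only [hy]
    exact (h.integral_sq_div_norm_le x hv hk).1.const_mul _
  · refine (hv.integrable_sq.mul_const (1 / 2 * ∫ x, (v x ^ 2 + ‖k x‖ ^ 2))).mono'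
      hm.norm.integral_prod_right' (ae_of_all _ fun x => ?_)
    rw [Real.norm_of_nonneg (integral_nonneg fun _ => norm_nonneg _)]
    have hnn : ∀ y, ‖v x ^ 2 * v y ^ 2 / ‖x - y‖‖ = v x ^ 2 * (v y ^ 2 / ‖y - x‖) := fun y => by
      rw [hy, Real.norm_of_nonneg (by positivity)]
    simp only [hnn, integral_const_mul]
    exact mul_le_mul_of_nonneg_left (h.integral_sq_div_norm_le x hv hk).2 (sq_nonneg _)

theorem thomasFermiWeizsacker_sq (lam γ Z : ℝ) (h : HasWeakGradient v k) (hv : MemLp v 2 volume)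
    (hk : MemLp k 2 volume) (hnn : ∀ x, 0 ≤ v x) :
    thomasFermiWeizsacker lam γ Z (fun x => v x ^ 2) =
      lam / 2 * (∫ x, ‖k x‖ ^ 2) + (3 / 5 * γ * (∫ x, (v x ^ 2) ^ (5 / 3 : ℝ))
        - Z * ∫ x, v x ^ 2 / ‖x‖) + 1 / 2 * ∫ p : R3 × R3, v p.1 ^ 2 * v p.2 ^ 2 / ‖p.1 - p.2‖
          ∂((volume : Measure R3).prod volume) := by
  have hs : (fun y => Real.sqrt (v y ^ 2)) = v := funext fun y => Real.sqrt_sq (hnn y)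
  have h1 : ∫ x, ‖weakGradient v x‖ ^ 2 = ∫ x, ‖k x‖ ^ 2 := by
    refine integral_congr_ae ?_
    filter_upwards [weakGradient_ae_eq h] with x hx
    rw [hx]
  have h2 : ∀ x : R3, 3 / 5 * γ * (v x ^ 2) ^ (5 / 3 : ℝ) - Z / ‖x‖ * v x ^ 2
      = 3 / 5 * γ * (v x ^ 2) ^ (5 / 3 : ℝ) - Z * (v x ^ 2 / ‖x‖) := fun x => by ring
  have hH : Integrable (fun x => v x ^ 2 / ‖x‖) volume := by
    simpa using (h.integral_sq_div_norm_le 0 hv hk).1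
  simp only [thomasFermiWeizsacker, thomasFermi, coulombEnergy, hs, h1, h2]
  rw [integral_sub ((h.integrable_sq_rpow hv hk).const_mul _) (hH.const_mul _),
    integral_const_mul, integral_const_mul, integral_prod _ (h.integrable_coulomb hv hk)]
  ring

theorem sq_mem_densities (h : HasWeakGradient v k) (hv : MemLp v 2 volume)
    (hk : MemLp k 2 volume) (hnn : ∀ x, 0 ≤ v x) : (fun x => v x ^ 2) ∈ densities := by
  have hs : (fun y => Real.sqrt (v y ^ 2)) = v := funext fun y => Real.sqrt_sq (hnn y)
  refine ⟨ae_of_all _ fun x => sq_nonneg _, ?_⟩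
  simp only [hs]
  exact ⟨hv, k, h, hk⟩

/-- A density is nonnegative only almost everywhere; this permits working with `u²`, `u = √ρ`, which
is nonnegative everywhere. -/
theorem thomasFermiWeizsacker_sq_sqrt (lam γ Z : ℝ) {ρ : R3 → ℝ} (hρ : ∀ᵐ x, 0 ≤ ρ x) :
    thomasFermiWeizsacker lam γ Z (fun x => Real.sqrt (ρ x) ^ 2) =
      thomasFermiWeizsacker lam γ Z ρ := by
  have h0 : ∀ᵐ x, Real.sqrt (ρ x) ^ 2 = ρ x := hρ.mono fun x hx => Real.sq_sqrt hx
  have h1 : ∀ x, Real.sqrt (Real.sqrt (ρ x) ^ 2) = Real.sqrt (ρ x) :=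
    fun x => Real.sqrt_sq (Real.sqrt_nonneg _)
  simp only [thomasFermiWeizsacker, thomasFermi, coulombEnergy, h1]
  congr 2
  · refine integral_congr_ae ?_
    filter_upwards [h0] with x hx
    rw [hx]
  · congr 1
    refine integral_congr_ae ?_
    filter_upwards [h0] with x hx
    refine integral_congr_ae ?_
    filter_upwards [h0] with y hy
    rw [hx, hy]

end Energy

/-! ### The first variation in the direction of the weight. -/

section Variation

theorem integral_sub_mul_add_mul {α : Type*} [MeasurableSpace α] {μ : Measure α}
    {f h l : α → ℝ} (hf : Integrable f μ) (hh : Integrable h μ) (hl : Integrable l μ) (c d : ℝ) :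
    ∫ x, (f x - c * h x + d * l x) ∂μ = (∫ x, f x ∂μ) - c * (∫ x, h x ∂μ) + d * ∫ x, l x ∂μ := by
  have h1 : Integrable (fun x => f x - c * h x) μ := hf.sub (hh.const_mul c)
  rw [integral_add h1 (hl.const_mul d), integral_sub hf (hh.const_mul c), integral_const_mul,
    integral_const_mul]

variable {lam γ Z δ ε : ℝ} {u : R3 → ℝ} {g : R3 → R3}

/-- The positive part of the remainder is `(a+b)² + 2ab + (ab)² ≤ 7τ²`, so 8 is ample. -/
theorem one_sub_sq_mul_one_sub_sq_le {a b τ : ℝ} (ha : 0 ≤ a) (hb : 0 ≤ b) (haτ : a ≤ τ)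
    (hbτ : b ≤ τ) (hτ : τ ≤ 1) : (1 - a) ^ 2 * (1 - b) ^ 2 ≤ 1 - 2 * (a + b) + 8 * τ ^ 2 := by
  have h1 : a * b ≤ τ ^ 2 := by nlinarith
  have h0 : 0 ≤ a * b := mul_nonneg ha hb
  have h2 : a ^ 2 ≤ τ ^ 2 := by gcongr
  have h3 : b ^ 2 ≤ τ ^ 2 := by gcongr
  have hab : a * b ≤ 1 := h1.trans (pow_le_one₀ (ha.trans haτ) hτ)
  have h4 : (a * b) ^ 2 ≤ a * b := by nlinarith
  have h5 : 0 ≤ a * b * (a + b) := by positivity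
  nlinarith

/-- The true first-order coefficient is `10/3`; coefficient 1 suffices, as this term only has to
supply strictness. -/
theorem sq_one_sub_mul_rpow_le {a w : ℝ} (ha : 0 ≤ a) (ha1 : a ≤ 1) (hw : 0 ≤ w) :
    ((1 - a) ^ 2 * w) ^ (5 / 3 : ℝ) ≤ w ^ (5 / 3 : ℝ) - a * w ^ (5 / 3 : ℝ) := by
  rw [Real.mul_rpow (sq_nonneg _) hw]
  have h1 : ((1 - a) ^ 2) ^ (5 / 3 : ℝ) ≤ 1 - a := by
    have h2 : (1 - a) ^ 2 ≤ 1 - a := by nlinarith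
    calc ((1 - a) ^ 2) ^ (5 / 3 : ℝ) ≤ (1 - a) ^ (5 / 3 : ℝ) := by
          gcongr
      _ ≤ (1 - a) ^ (1 : ℝ) := Real.rpow_le_rpow_of_exponent_ge_of_imp (by linarith) (by linarith)
          (by norm_num) (fun _ h => absurd h (by norm_num))
      _ = 1 - a := Real.rpow_one _
  have h3 := mul_le_mul_of_nonneg_right h1 (Real.rpow_nonneg hw (5 / 3 : ℝ))
  linarith

/-- The first-order condition for the minimizer `u²` in the direction `-η u²`. -/
theorem weighted_virial_le (hlam : 0 < lam) (hγ : 0 < γ) (hZ : 0 < Z)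
    (h : HasWeakGradient u g) (hu : MemLp u 2 volume) (hg : MemLp g 2 volume)
    (hnn : ∀ x, 0 ≤ u x)
    (hmin : ∀ σ ∈ densities, thomasFermiWeizsacker lam γ Z (fun x => u x ^ 2) ≤
      thomasFermiWeizsacker lam γ Z σ) (hδ : 0 < δ) (hε : 0 < ε) :
    3 / 5 * γ * (∫ x, weight δ ε 0 x * (u x ^ 2) ^ (5 / 3 : ℝ)) +
      ∫ p : R3 × R3, (weight δ ε 0 p.1 + weight δ ε 0 p.2) *
        (u p.1 ^ 2 * u p.2 ^ 2 / ‖p.1 - p.2‖) ∂((volume : Measure R3).prod volume) ≤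
      2 * (Z * ∫ x, weight δ ε 0 x * (u x ^ 2 / ‖x‖)) := by
  set η := weight δ ε 0 with hη
  set κ := weightProfile δ ε 0
  have hη0 : ∀ x, 0 ≤ η x := fun x => weight_nonneg 0 x hδ hε.le
  have hη1 : ∀ x, η x ≤ 1 / ε := fun x => weight_le 0 x hδ hε
  have hηs : ContDiff ℝ ∞ η := contDiff_weight 0 hδ hε.le
  have hηc := hηs.continuous
  have hηn : ∀ x, ‖η x‖ ≤ 1 / ε := fun x => by rw [Real.norm_of_nonneg (hη0 x)]; exact hη1 x
  have iH : Integrable (fun x => u x ^ 2 / ‖x‖) volume := by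
    simpa using (h.integral_sq_div_norm_le 0 hu hg).1
  have iT := h.integrable_sq_rpow hu hg
  have iC := h.integrable_coulomb hu hg
  have iηH : Integrable (fun x => η x * (u x ^ 2 / ‖x‖)) volume :=
    iH.bdd_mul hηc.aestronglyMeasurable (ae_of_all _ hηn)
  have iηT : Integrable (fun x => η x * (u x ^ 2) ^ (5 / 3 : ℝ)) volume :=
    iT.bdd_mul hηc.aestronglyMeasurable (ae_of_all _ hηn)
  have iηC : Integrable (fun p : R3 × R3 => (η p.1 + η p.2) *
      (u p.1 ^ 2 * u p.2 ^ 2 / ‖p.1 - p.2‖)) ((volume : Measure R3).prod volume) :=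
    iC.bdd_mul (c := 1 / ε + 1 / ε) (by fun_prop)
      (ae_of_all _ fun p => (norm_add_le _ _).trans (add_le_add (hηn _) (hηn _)))
  set q : R3 → ℝ := fun x => η x * ‖g x‖ ^ 2 + u x * (κ x * ⟪g x, x - 0⟫) with hq
  have iA : Integrable q volume := integrable_weight_mul 0 hu hg hδ hε
  have hA : 0 ≤ ∫ x, q x := h.integral_weight_mul_nonneg 0 hu hg hδ hε
  -- This is `∇(ηu)`, so `q = ⟪∇u, ∇(ηu)⟫` and `∫ q ≥ 0` is Lieb's positivity.
  set f : R3 → R3 := fun x => η x • g x + u x • ∇ η x with hf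
  have hgradη : ∀ x, ∇ η x = κ x • (x - 0) := fun x => gradient_weight 0 x hδ hε.le
  have mηu : MemLp (fun x => η x * u x) 2 volume :=
    hu.of_le_mul (c := 1 / ε) (hηc.aestronglyMeasurable.mul hu.1) (ae_of_all _ fun x => by
      rw [norm_mul]; exact mul_le_mul_of_nonneg_right (hηn x) (norm_nonneg _))
  have mf : MemLp f 2 volume := by
    refine MemLp.add ?_ ?_
    · exact hg.of_le_mul (c := 1 / ε) (hηc.aestronglyMeasurable.smul hg.1) (ae_of_all _ fun x => by
        rw [norm_smul]; exact mul_le_mul_of_nonneg_right (hηn x) (norm_nonneg _))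
    · refine hu.of_le (hu.1.smul (contDiff_gradient hηs).continuous.aestronglyMeasurable)
        (ae_of_all _ fun x => ?_)
      rw [norm_smul]
      refine mul_le_of_le_one_right (norm_nonneg _) ?_
      rw [hgradη, norm_smul, Real.norm_of_nonneg (weightProfile_nonneg 0 x hδ)]
      exact weightProfile_mul_norm_le 0 x hδ hε.le
  have hinner : ∀ x, ⟪g x, f x⟫ = q x := fun x => by
    simp only [hf, hq, hgradη, inner_add_right, inner_smul_right, real_inner_self_eq_norm_sq]
  set G := ∫ x, η x * (u x ^ 2) ^ (5 / 3 : ℝ)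
  set Q := ∫ p : R3 × R3, (η p.1 + η p.2) *
        (u p.1 ^ 2 * u p.2 ^ 2 / ‖p.1 - p.2‖) ∂((volume : Measure R3).prod volume)
  set P := ∫ x, η x * (u x ^ 2 / ‖x‖)
  set A := ∫ x, q x
  set B := ∫ x, ‖f x‖ ^ 2
  set D := ∫ p : R3 × R3, u p.1 ^ 2 * u p.2 ^ 2 / ‖p.1 - p.2‖ ∂((volume : Measure R3).prod volume)
  -- Since `η ≤ 1/ε`, the restriction `t ≤ ε` keeps `1 - tη ≥ 0`, so the trial function is the
  -- square root of its density. The right side collects the second-order terms, already divided by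
  -- `t`.
  have key : ∀ t : ℝ, 0 < t → t ≤ ε →
      lam * A + 3 / 5 * γ * G + Q - 2 * (Z * P) ≤ t * (lam / 2 * B + 4 / ε ^ 2 * D) := by
    intro t ht htε
    have ha0 : ∀ x, 0 ≤ t * η x := fun x => mul_nonneg ht.le (hη0 x)
    have haτ : ∀ x, t * η x ≤ t / ε := fun x => by
      have := mul_le_mul_of_nonneg_left (hη1 x) ht.le
      rwa [mul_one_div] at this
    have hτ1 : t / ε ≤ 1 := (div_le_one hε).2 htε
    have ha1 : ∀ x, t * η x ≤ 1 := fun x => (haτ x).trans hτ1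
    let v : R3 → ℝ := fun x => (1 - t * η x) * u x
    let k : R3 → R3 := fun x => g x - t • f x
    have hs1 : ContDiff ℝ ∞ fun x => 1 - t * η x := contDiff_const.sub (contDiff_const.mul hηs)
    have hvk : HasWeakGradient v k := by
      have h1 := h.smooth_mul hs1
      have h2 : (fun x => (1 - t * η x) • g x + u x • ∇ (fun x => 1 - t * η x) x) = k := by
        ext1 x
        have h3 : ∇ (fun x => 1 - t * η x) x = -(t • ∇ η x) := by
          refine ext_inner_right ℝ fun w => ?_
          have h4 := (((hηs.differentiable (by simp)) x).hasFDerivAt.const_mul t).const_sub 1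
          rw [inner_gradient_left, h4.fderiv, inner_neg_left, inner_smul_left, inner_gradient_left]
          simp
        simp only [h3, k, hf]
        module
      rw [h2] at h1
      exact h1
    have mv : MemLp v 2 volume := by
      have : v = fun x => u x - t * (η x * u x) := by ext1 x; simp only [v]; ring
      rw [this]
      exact hu.sub (mηu.const_mul t)
    have mk : MemLp k 2 volume := hg.sub (mf.const_smul t)
    have hv0 : ∀ x, 0 ≤ v x := fun x => mul_nonneg (by linarith [ha1 x]) (hnn x)
    have hE := hmin _ (sq_mem_densities hvk mv mk hv0)
    rw [thomasFermiWeizsacker_sq lam γ Z h hu hg hnn,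
      thomasFermiWeizsacker_sq lam γ Z hvk mv mk hv0] at hE
    have hkin : ∫ x, ‖k x‖ ^ 2 = (∫ x, ‖g x‖ ^ 2) - 2 * t * A + t ^ 2 * B := by
      have h1 : ∀ x, ‖k x‖ ^ 2 = ‖g x‖ ^ 2 - 2 * t * q x + t ^ 2 * ‖f x‖ ^ 2 := fun x => by
        simp only [k]
        rw [norm_sub_sq_real, inner_smul_right, hinner, norm_smul, mul_pow, Real.norm_eq_abs,
          sq_abs]
        ring
      simp only [h1]
      exact integral_sub_mul_add_mul hg.norm.integrable_sq iA mf.norm.integrable_sq _ _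
    have hTF : ∫ x, (v x ^ 2) ^ (5 / 3 : ℝ) ≤ (∫ x, (u x ^ 2) ^ (5 / 3 : ℝ)) - t * G := by
      rw [← integral_const_mul, ← integral_sub iT (iηT.const_mul t)]
      refine integral_mono (hvk.integrable_sq_rpow mv mk) (iT.sub (iηT.const_mul t)) fun x => ?_
      have := sq_one_sub_mul_rpow_le (ha0 x) (ha1 x) (sq_nonneg (u x))
      simp only [v, mul_pow]
      linarith
    have hNuc : (∫ x, u x ^ 2 / ‖x‖) - 2 * t * P ≤ ∫ x, v x ^ 2 / ‖x‖ := by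
      rw [← integral_const_mul, ← integral_sub iH (iηH.const_mul _)]
      refine integral_mono (iH.sub (iηH.const_mul _)) ?_ fun x => ?_
      · simpa using (hvk.integral_sq_div_norm_le 0 mv mk).1
      · have h1 : 0 ≤ u x ^ 2 / ‖x‖ := by positivity
        have h2 : v x ^ 2 / ‖x‖ = (1 - t * η x) ^ 2 * (u x ^ 2 / ‖x‖) := by
          simp only [v]; ring
        simp only [h2]
        nlinarith [mul_nonneg (sq_nonneg (t * η x)) h1]
    have hCoul : ∫ p : R3 × R3, v p.1 ^ 2 * v p.2 ^ 2 / ‖p.1 - p.2‖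
        ∂((volume : Measure R3).prod volume) ≤ D - 2 * t * Q + 8 * (t / ε) ^ 2 * D := by
      rw [← integral_sub_mul_add_mul iC iηC iC]
      refine integral_mono (hvk.integrable_coulomb mv mk)
        ((iC.sub (iηC.const_mul _)).add (iC.const_mul _)) fun p => ?_
      have h1 : 0 ≤ u p.1 ^ 2 * u p.2 ^ 2 / ‖p.1 - p.2‖ := by positivity
      have h2 : v p.1 ^ 2 * v p.2 ^ 2 / ‖p.1 - p.2‖ =
          ((1 - t * η p.1) ^ 2 * (1 - t * η p.2) ^ 2) *
            (u p.1 ^ 2 * u p.2 ^ 2 / ‖p.1 - p.2‖) := by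
        simp only [v]; ring
      have h3 := mul_le_mul_of_nonneg_right (one_sub_sq_mul_one_sub_sq_le (ha0 p.1) (ha0 p.2)
        (haτ p.1) (haτ p.2) hτ1) h1
      simp only [h2]
      refine h3.trans (le_of_eq ?_)
      ring
    rw [hkin] at hE
    have hTF' := mul_le_mul_of_nonneg_left hTF (by positivity : 0 ≤ 3 / 5 * γ)
    have hNuc' := mul_le_mul_of_nonneg_left hNuc hZ.le
    have hfin : t * (lam * A + 3 / 5 * γ * G + Q - 2 * (Z * P)) ≤
        t * (t * (lam / 2 * B + 4 / ε ^ 2 * D)) := by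
      have e1 : t * (t * (lam / 2 * B + 4 / ε ^ 2 * D)) =
          lam / 2 * (t ^ 2 * B) + 1 / 2 * (8 * (t / ε) ^ 2 * D) := by
        field_simp
        ring
      rw [e1]
      linarith
    exact le_of_mul_le_mul_left hfin ht
  have hlim : Tendsto (fun t : ℝ => t * (lam / 2 * B + 4 / ε ^ 2 * D)) (𝓝[>] 0) (𝓝 0) := by
    have : Tendsto (fun t : ℝ => t * (lam / 2 * B + 4 / ε ^ 2 * D)) (𝓝 0)
        (𝓝 (0 * (lam / 2 * B + 4 / ε ^ 2 * D))) := tendsto_id.mul_const _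
    rw [zero_mul] at this
    exact this.mono_left nhdsWithin_le_nhds
  have hle : lam * A + 3 / 5 * γ * G + Q - 2 * (Z * P) ≤ 0 := by
    refine ge_of_tendsto hlim ?_
    filter_upwards [Ioc_mem_nhdsGT hε] with t ht using key t ht.1 ht.2
  have := mul_nonneg hlam.le hA
  linarith

end Variation

/-! ### Removing the regularization. -/

section Bound

variable {δ ε : ℝ}

/-- A lower bound free of `δ` and `ε`, so the Thomas-Fermi term survives the limit. -/
theorem div_one_add_norm_le_weight (hδ : 0 < δ) (hε : 0 ≤ ε) (hε1 : ε ≤ 1) (x : R3) :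
    ‖x‖ / (1 + ‖x‖) ≤ weight δ ε 0 x := by
  have hs := regDist_pos 0 x hδ
  have hr := norm_sub_le_regDist (δ := δ) 0 x
  rw [sub_zero] at hr
  unfold weight
  rw [div_le_div_iff₀ (by positivity) (by positivity)]
  nlinarith [norm_nonneg x, mul_nonneg (norm_nonneg x) hs.le]

/-- The triangle inequality, transported through `r ↦ r/(1 + εr)`, which is increasing and
subadditive. -/
theorem div_le_weight_add_weight (hδ : 0 < δ) (hε : 0 ≤ ε) (x y : R3) :
    ‖x - y‖ / (1 + ε * ‖x - y‖) ≤ weight δ ε 0 x + weight δ ε 0 y := by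
  have hx := regDist_pos 0 x hδ
  have hy := regDist_pos 0 y hδ
  have hr : ‖x - y‖ ≤ regDist δ 0 x + regDist δ 0 y := by
    have h1 := norm_sub_le_regDist (δ := δ) 0 x
    have h2 := norm_sub_le_regDist (δ := δ) 0 y
    rw [sub_zero] at h1 h2
    exact (norm_sub_le x y).trans (add_le_add h1 h2)
  have hn := norm_nonneg (x - y)
  unfold weight
  set s := regDist δ 0 x
  set t := regDist δ 0 y
  calc ‖x - y‖ / (1 + ε * ‖x - y‖) ≤ (s + t) / (1 + ε * (s + t)) := by
        rw [div_le_div_iff₀ (by positivity) (by positivity)]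
        nlinarith
    _ = s / (1 + ε * (s + t)) + t / (1 + ε * (s + t)) := add_div _ _ _
    _ ≤ s / (1 + ε * s) + t / (1 + ε * t) := by
        gcongr <;> linarith


theorem weight_mul_div_norm_le (hδ : 0 < δ) (hε : 0 ≤ ε) (x : R3) {w : ℝ} (hw : 0 ≤ w) :
    weight δ ε 0 x * (w / ‖x‖) ≤ w + δ * (w / ‖x‖) := by
  have h1 : weight δ ε 0 x ≤ ‖x‖ + δ := by
    have := (weight_le_regDist 0 x hδ hε).trans (regDist_le 0 x hδ.le)
    rwa [sub_zero] at this
  have h2 := mul_le_mul_of_nonneg_right h1 (div_nonneg hw (norm_nonneg x))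
  have h3 : ‖x‖ * (w / ‖x‖) ≤ w := by
    rcases (norm_nonneg x).eq_or_lt with h0 | h0
    · simp [← h0, hw]
    · rw [mul_div_cancel₀ _ h0.ne']
  linarith

variable {lam γ Z : ℝ} {u : R3 → ℝ} {g : R3 → R3}

/-- The limit `δ = ε → 0` of the variational inequality. The repulsion dominates `∬ ρρ/(1 +
ε|x-y|)`, which tends to `N²` by dominated convergence; the attraction is at most `Z(N + εK)` up to
the factor 2. -/
theorem charge_sq_le (hlam : 0 < lam) (hγ : 0 < γ) (hZ : 0 < Z)
    (h : HasWeakGradient u g) (hu : MemLp u 2 volume) (hg : MemLp g 2 volume)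
    (hnn : ∀ x, 0 ≤ u x)
    (hmin : ∀ σ ∈ densities, thomasFermiWeizsacker lam γ Z (fun x => u x ^ 2) ≤
      thomasFermiWeizsacker lam γ Z σ) :
    3 / 5 * γ * (∫ x, ‖x‖ / (1 + ‖x‖) * (u x ^ 2) ^ (5 / 3 : ℝ)) + (∫ x, u x ^ 2) ^ 2 ≤
      2 * Z * ∫ x, u x ^ 2 := by
  set G := ∫ x, ‖x‖ / (1 + ‖x‖) * (u x ^ 2) ^ (5 / 3 : ℝ)
  set N := ∫ x, u x ^ 2
  set K := ∫ x, u x ^ 2 / ‖x‖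
  have iN := hu.integrable_sq
  have iH : Integrable (fun x => u x ^ 2 / ‖x‖) volume := by
    simpa using (h.integral_sq_div_norm_le 0 hu hg).1
  have iT := h.integrable_sq_rpow hu hg
  have iC := h.integrable_coulomb hu hg
  have iNN : Integrable (fun p : R3 × R3 => u p.1 ^ 2 * u p.2 ^ 2)
      ((volume : Measure R3).prod volume) := iN.mul_prod iN
  have hNN : ∫ p : R3 × R3, u p.1 ^ 2 * u p.2 ^ 2 ∂((volume : Measure R3).prod volume) = N ^ 2 := by
    rw [integral_prod_mul (fun x => u x ^ 2) (fun x => u x ^ 2), sq]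
  have iR : ∀ ε : ℝ, 0 ≤ ε → Integrable (fun p : R3 × R3 => (1 + ε * ‖p.1 - p.2‖)⁻¹ *
      (u p.1 ^ 2 * u p.2 ^ 2)) ((volume : Measure R3).prod volume) := fun ε hε => by
    refine iNN.bdd_mul (c := 1) (Continuous.aestronglyMeasurable ?_) (ae_of_all _ fun p => ?_)
    · exact Continuous.inv₀ (by fun_prop) fun p => by positivity
    · rw [Real.norm_of_nonneg (by positivity)]
      exact inv_le_one_of_one_le₀ (le_add_of_nonneg_right (by positivity))
  have key : ∀ ε : ℝ, 0 < ε → ε ≤ 1 → 3 / 5 * γ * G +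
      ∫ p : R3 × R3, (1 + ε * ‖p.1 - p.2‖)⁻¹ * (u p.1 ^ 2 * u p.2 ^ 2)
        ∂((volume : Measure R3).prod volume) ≤ 2 * (Z * (N + ε * K)) := by
    intro ε hε hε1
    have hv := weighted_virial_le hlam hγ hZ h hu hg hnn hmin hε hε
    have hηc := (contDiff_weight (0 : R3) hε hε.le).continuous
    have hηn : ∀ x, ‖weight ε ε 0 x‖ ≤ 1 / ε := fun x => by
      rw [Real.norm_of_nonneg (weight_nonneg 0 x hε hε.le)]; exact weight_le 0 x hε hε
    have iηT : Integrable (fun x => weight ε ε 0 x * (u x ^ 2) ^ (5 / 3 : ℝ)) volume :=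
      iT.bdd_mul hηc.aestronglyMeasurable (ae_of_all _ hηn)
    have hG : G ≤ ∫ x, weight ε ε 0 x * (u x ^ 2) ^ (5 / 3 : ℝ) := by
      refine integral_mono_of_nonneg (ae_of_all _ fun x => by positivity) iηT
        (ae_of_all _ fun x => ?_)
      exact mul_le_mul_of_nonneg_right (div_one_add_norm_le_weight hε hε.le hε1 x) (by positivity)
    have hP : ∫ x, weight ε ε 0 x * (u x ^ 2 / ‖x‖) ≤ N + ε * K := by
      rw [← integral_const_mul, ← integral_add iN (iH.const_mul ε)]
      refine integral_mono_of_nonneg (ae_of_all _ fun x => ?_) (iN.add (iH.const_mul ε))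
        (ae_of_all _ fun x => weight_mul_div_norm_le hε hε.le x (sq_nonneg _))
      exact mul_nonneg (weight_nonneg 0 x hε hε.le) (by positivity)
    have hQ : ∫ p : R3 × R3, (1 + ε * ‖p.1 - p.2‖)⁻¹ * (u p.1 ^ 2 * u p.2 ^ 2)
        ∂((volume : Measure R3).prod volume) ≤
        ∫ p : R3 × R3, (weight ε ε 0 p.1 + weight ε ε 0 p.2) *
          (u p.1 ^ 2 * u p.2 ^ 2 / ‖p.1 - p.2‖) ∂((volume : Measure R3).prod volume) := by
      refine integral_mono_ae (iR ε hε.le)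
        (iC.bdd_mul (c := 1 / ε + 1 / ε) (by fun_prop)
          (ae_of_all _ fun p => (norm_add_le _ _).trans (add_le_add (hηn _) (hηn _)))) ?_
      -- On the diagonal the quotient is 0 by convention and the pointwise bound can fail, but the
      -- diagonal is null.
      have hne : ∀ᵐ p ∂((volume : Measure R3).prod volume), p.1 ≠ p.2 := by
        refine (Measure.ae_prod_iff_ae_ae (p := fun q : R3 × R3 => q.1 ≠ q.2)
          (measurableSet_eq_fun measurable_fst measurable_snd).compl).2 (ae_of_all _ fun x => ?_)
        simp [ae_iff]
      filter_upwards [hne] with p hp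
      have hr : 0 < ‖p.1 - p.2‖ := norm_pos_iff.2 (sub_ne_zero.2 hp)
      have h1 := mul_le_mul_of_nonneg_right (div_le_weight_add_weight hε hε.le p.1 p.2)
        (by positivity : 0 ≤ u p.1 ^ 2 * u p.2 ^ 2 / ‖p.1 - p.2‖)
      refine le_trans (le_of_eq ?_) h1
      field_simp
    have hG' := mul_le_mul_of_nonneg_left hG (by positivity : 0 ≤ 3 / 5 * γ)
    have hP' := mul_le_mul_of_nonneg_left hP hZ.le
    linarith
  let d : ℕ → ℝ := fun n => 1 / ((n : ℝ) + 1)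
  have hd : ∀ n, 0 < d n := fun n => by positivity
  have hd0 : Tendsto d atTop (𝓝 0) := tendsto_one_div_add_atTop_nhds_zero_nat
  have hd1 : ∀ n, d n ≤ 1 := fun n =>
    div_le_one_of_le₀ (le_add_of_nonneg_left (Nat.cast_nonneg n)) (by positivity)
  have lR : Tendsto (fun n => ∫ p : R3 × R3, (1 + d n * ‖p.1 - p.2‖)⁻¹ * (u p.1 ^ 2 * u p.2 ^ 2)
      ∂((volume : Measure R3).prod volume)) atTop (𝓝 (N ^ 2)) := by
    rw [← hNN]
    refine tendsto_integral_of_dominated_convergence (fun p => u p.1 ^ 2 * u p.2 ^ 2)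
      (fun n => (iR (d n) (hd n).le).1) iNN (fun n => ae_of_all _ fun p => ?_)
      (ae_of_all _ fun p => ?_)
    · have hdn := hd n
      rw [Real.norm_of_nonneg (by positivity)]
      exact mul_le_of_le_one_left (by positivity)
        (inv_le_one_of_one_le₀ (le_add_of_nonneg_right (by positivity)))
    · have h1 : Tendsto (fun n => 1 + d n * ‖p.1 - p.2‖) atTop (𝓝 1) := by
        simpa using (hd0.mul_const ‖p.1 - p.2‖).const_add 1
      simpa using (h1.inv₀ one_ne_zero).mul_const (u p.1 ^ 2 * u p.2 ^ 2)
  have lr : Tendsto (fun n => 2 * (Z * (N + d n * K))) atTop (𝓝 (2 * Z * N)) := by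
    have := (((hd0.mul_const K).const_add N).const_mul Z).const_mul 2
    simpa [mul_assoc] using this
  exact le_of_tendsto_of_tendsto' (lR.const_add _) lr fun n => key (d n) (hd n) (hd1 n)

end Bound

end TFW

/-! ### The strict bound on the mass. -/

theorem mainTheorem9 (lam γ Z : ℝ) (hlam : 0 < lam) (hγ : 0 < γ) (hZ : 0 < Z)
    (ρ : TFW.R3 → ℝ) (hρ : TFW.IsTFWMinimizer lam γ Z ρ) :
    ∫ x, ρ x < 2 * Z := by
  obtain ⟨hd, hmin⟩ := hρ
  obtain ⟨hnn, hu, g, hug, hg⟩ := hd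
  set u : TFW.R3 → ℝ := fun x => Real.sqrt (ρ x) with hu_def
  have hsq : (fun x => u x ^ 2) =ᵐ[volume] ρ := hnn.mono fun x hx => Real.sq_sqrt hx
  have hu0 : ∀ x, 0 ≤ u x := fun x => Real.sqrt_nonneg _
  have hmin' : ∀ σ ∈ TFW.densities, TFW.thomasFermiWeizsacker lam γ Z (fun x => u x ^ 2) ≤
      TFW.thomasFermiWeizsacker lam γ Z σ := fun σ hσ =>
    (TFW.thomasFermiWeizsacker_sq_sqrt lam γ Z hnn).trans_le (hmin hσ)
  have main := TFW.charge_sq_le hlam hγ hZ hug hu hg hu0 hmin'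
  rw [← integral_congr_ae hsq]
  have hN0 : 0 ≤ ∫ x, u x ^ 2 := integral_nonneg fun x => sq_nonneg _
  rcases hN0.eq_or_lt with hN | hN
  · rw [← hN]
    positivity
  have hGnn : ∀ x : TFW.R3, 0 ≤ ‖x‖ / (1 + ‖x‖) * (u x ^ 2) ^ (5 / 3 : ℝ) := fun x => by positivity
  have iG : Integrable (fun x : TFW.R3 => ‖x‖ / (1 + ‖x‖) * (u x ^ 2) ^ (5 / 3 : ℝ)) volume := by
    refine (hug.integrable_sq_rpow hu hg).bdd_mul (c := 1)
      (Continuous.aestronglyMeasurable ?_) (ae_of_all _ fun x => ?_)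
    · exact Continuous.div (by fun_prop) (by fun_prop) fun x => by positivity
    · rw [Real.norm_of_nonneg (by positivity)]
      exact div_le_one_of_le₀ (by linarith) (by positivity)
  -- The weight vanishes only at the origin, so a zero integral would force `u = 0` a.e. and thus
  -- zero mass.
  have hG : 0 < ∫ x : TFW.R3, ‖x‖ / (1 + ‖x‖) * (u x ^ 2) ^ (5 / 3 : ℝ) := by
    refine (integral_nonneg hGnn).lt_of_ne fun h0 => hN.ne' ?_
    have h1 := (integral_eq_zero_iff_of_nonneg hGnn iG).1 h0.symm
    refine integral_eq_zero_of_ae ?_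
    have hne : ∀ᵐ x : TFW.R3, x ≠ 0 := by simp [ae_iff]
    filter_upwards [h1, hne] with x hx hx0
    have h2 : ‖x‖ / (1 + ‖x‖) ≠ 0 := (div_pos (norm_pos_iff.2 hx0) (by positivity)).ne'
    have h3 := (mul_eq_zero.1 hx).resolve_left h2
    exact (Real.rpow_eq_zero (sq_nonneg _) (by norm_num)).1 h3
  have hpos : 0 < 3 / 5 * γ * ∫ x : TFW.R3, ‖x‖ / (1 + ‖x‖) * (u x ^ 2) ^ (5 / 3 : ℝ) := by positivity
  refine lt_of_mul_lt_mul_right (a := ∫ x, u x ^ 2) ?_ hN0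
  rw [← sq]
  linarith
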